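/- All Banach spaces are complex. A cosine operator function (COF) on a Banach space $X$ is a strongly continuous family $(C(t))_{t\in\mathbb R}\subset\mathcal L(X)$ with $C(0)=I$ and $C(t+s)+C(t-s)=2C(t)C(s)$ for all $s,t\in\mathbb R$; its generator is the operator $Ax=\lim_{t\to0}\frac{2}{t^2}(C(t)x-x)$, defined for exactly those $x\in X$ for which the limit exists. For a closed operator $A$ on $X$, let $[D(A)]$ be its domain with the graph norm. We say that $A$ generates a COF with associated phase space $V\times X$ if $A$ generates a COF on $X$, $V$ is a Banach space with continuous embeddings $[D(A)]\hookrightarrow V\hookrightarrow X$, and the operator matrix $\begin{pmatrix}0&I_V\\A&0\end{pmatrix}$ with domain $D(A)\times V$ generates a $C_0$-semigroup on $V\times X$. A classical solution of $\ddot u=Au$ is a function $u\in C^2(\mathbb R,X)$ with $u(t)\in D(A)$ and $\ddot u(t)=Au(t)$ for all $t\in\mathbb R$. The initial value problem for $\ddot u=Au$ is called well-posed (with respect to $V\times X$, where $D(A)\subset V\hookrightarrow X$) if for all $f\in D(A)$ and $g\in V$ there is exactly one classical solution with $u(0)=f$, $\dot u(0)=g$; if $D(A)\times V$ is dense in $V\times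 X$; and if for each $\tau\ge 0$ there is a constant $M$ such that every classical solution satisfies, for $|t|\le\tau$, both $\|u(t)\|_V+\|\dot u(t)\|_X\le M(\|u(0)\|_V+\|\dot u(0)\|_X)$ and $\|u(t)\|_X\le M(\|u(0)\|_X+\|\dot u(0)\|_X)$. **Theorem 4.1.** Let $n\in\mathbb N$ and, for $1\le i\le n$, let $A_i$ be a closed operator on a Banach space $X_i$ that generates a COF with associated phase space $V_i\times X_i$. For $1\le h<k\le n$ let $B^h_k$ and $C^k_h$ be linear operators such that - $B^h_k\in\mathcal L([D(A_k)],V_h)$ or $B^h_k\in\mathcal L(V_k,X_h)$, and - $C^k_h\in\mathcal L([D(A_h)],V_k)$ or $C^k_h\in\mathcal L(V_h,X_k)$, where the alternative may depend on the operator. Consider the coupled system $$(\mathrm{CS}_n)\qquad \ddot u_i(t)=A_iu_i(t)+\sum_{k=i+1}^{n}B^i_k\,u_k(t)+\sum_{h=1}^{i-1}C^i_h\,u_h(t),\qquad t\in\mathbb R,\quad 1\le i\le n,$$ that is, $\ddot u=\mathcal Au$ on $\prod_{i=1}^nX_i$, where $\mathcal A$ is the operator matrix with diagonal entries $A_i$,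 entries $B^h_k$ above and $C^k_h$ below the diagonal, and domain $D(\mathcal A)=\prod_{i=1}^nD(A_i)$. Then $\mathcal A$ is closed and generates a COF on $\prod_{i=1}^nX_i$ with associated phase space $\big(\prod_{i=1}^nV_i\big)\times\big(\prod_{i=1}^nX_i\big)$; in particular, the initial value problem for $(\mathrm{CS}_n)$ is well-posed with respect to this phase space. -/

import Mathlib

open Set Filter Topology

noncomputable section

namespace CosineSystem

section OneOperator

variable {E F V X : Type*}
  [NormedAddCommGroup E] [NormedSpace ℂ E] [NormedAddCommGroup F] [NormedSpace ℂ F]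
  [NormedAddCommGroup V] [NormedSpace ℂ V] [NormedAddCommGroup X] [NormedSpace ℂ X]

/-- `(T t)`, `t ≥ 0`, is a strongly continuous semigroup of bounded operators on `E`
(the values at negative times are irrelevant). -/
structure IsC0Semigroup (T : ℝ → E →L[ℂ] E) : Prop where
  map_zero : T 0 = 1
  map_add : ∀ s t : ℝ, 0 ≤ s → 0 ≤ t → T (s + t) = T s * T t
  continuousOn : ∀ x : E, ContinuousOn (fun t : ℝ => T t x) (Ici 0)

/-- The unbounded operator `A` generates a C₀-semigroup on `E`: the graph of `A` consists of the
pairs `(x, y)` with `y = lim_{t → 0+} (T(t)x - x) / t`. In particular the domain of `A` is exactly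
the set of the `x` for which this limit exists. -/
def GeneratesC0Semigroup (A : E →ₗ.[ℂ] E) : Prop :=
  ∃ T : ℝ → E →L[ℂ] E, IsC0Semigroup T ∧
    ∀ x y : E, (x, y) ∈ A.graph ↔
      Tendsto (fun t : ℝ => t⁻¹ • (T t x - x)) (𝓝[>] 0) (𝓝 y)

/-- A cosine operator function on `E`: a strongly continuous family of bounded operators that
satisfies d'Alembert's functional equation. -/
structure IsCosineFunction (C : ℝ → E →L[ℂ] E) : Prop where
  map_zero : C 0 = 1
  dAlembert : ∀ t s : ℝ, C (t + s) + C (t - s) = (2 : ℂ) • (C t * C s)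
  continuous : ∀ x : E, Continuous (fun t : ℝ => C t x)

/-- The unbounded operator `A` generates a cosine operator function on `E`: the graph of `A`
consists of the pairs `(x, y)` with `y = lim_{t → 0} 2 (C(t)x - x) / t²`. In particular the domain
of `A` is exactly the set of the `x` for which this limit exists. -/
def GeneratesCOF (A : E →ₗ.[ℂ] E) : Prop :=
  ∃ C : ℝ → E →L[ℂ] E, IsCosineFunction C ∧
    ∀ x y : E, (x, y) ∈ A.graph ↔
      Tendsto (fun t : ℝ => (2 / t ^ 2) • (C t x - x)) (𝓝[≠] 0) (𝓝 y)

/-- The linear map `T`, defined on the domain of `A`, is bounded from `[D(A)]` (the domain of `A`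
with the graph norm) to `F`. -/
def GraphBounded (A : E →ₗ.[ℂ] E) (T : A.domain →ₗ[ℂ] F) : Prop :=
  ∃ c : ℝ, ∀ x : A.domain, ‖T x‖ ≤ c * (‖(x : E)‖ + ‖A x‖)

/-- `[D(A)] ↪ V`, where `V` is regarded as a subspace of `X` by means of `ι`. -/
def DomainEmbeds (ι : V →L[ℂ] X) (A : X →ₗ.[ℂ] X) : Prop :=
  ∃ j : A.domain →ₗ[ℂ] V, (∀ x : A.domain, ι (j x) = x) ∧ GraphBounded A j

/-- The operator matrix `(0, I; A, 0)` on `V × X` with domain `D(A) × V`, where `V` is regarded as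
a subspace of `X` by means of the injection `ι`: it sends `(v, ι w)`, with `ι v ∈ D(A)`,
to `(w, A (ι v))`. -/
def reductionMatrix (ι : V →L[ℂ] X) (hι : Function.Injective ι) (A : X →ₗ.[ℂ] X) :
    (V × X) →ₗ.[ℂ] (V × X) where
  domain := (A.domain.comap (ι : V →ₗ[ℂ] X)).prod (LinearMap.range (ι : V →ₗ[ℂ] X))
  toFun :=
    { toFun := fun p =>
        ((LinearEquiv.ofInjective (ι : V →ₗ[ℂ] X) hι).symm ⟨p.1.2, p.2.2⟩,
          A ⟨ι p.1.1, p.2.1⟩)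
      map_add' := by
        intro p q
        refine Prod.ext ?_ ?_
        · exact map_add (LinearEquiv.ofInjective (ι : V →ₗ[ℂ] X) hι).symm
            ⟨p.1.2, p.2.2⟩ ⟨q.1.2, q.2.2⟩
        · change A _ = A _ + A _
          rw [← LinearPMap.map_add]
          congr 1
          exact Subtype.ext (map_add ι p.1.1 q.1.1)
      map_smul' := by
        intro c p
        refine Prod.ext ?_ ?_
        · exact map_smul (LinearEquiv.ofInjective (ι : V →ₗ[ℂ] X) hι).symm c
            ⟨p.1.2, p.2.2⟩
        · change A _ = c • A _
          rw [← LinearPMap.map_smul]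
          congr 1
          exact Subtype.ext (map_smul ι c p.1.1) }

/-- `A` is a closed operator on `X` that generates a cosine operator function with associated phase
space `V × X`. Here `V` is a Banach space with `[D(A)] ↪ V ↪ X` (the second embedding is `ι`), and
the matrix `(0, I; A, 0)` with domain `D(A) × V` generates a C₀-semigroup on `V × X`. -/
structure GeneratesCOFWithPhaseSpace (ι : V →L[ℂ] X) (A : X →ₗ.[ℂ] X) : Prop where
  isClosed : A.IsClosed
  generatesCOF : GeneratesCOF A
  injective : Function.Injective ι
  domainEmbeds : DomainEmbeds ι A
  reduction : GeneratesC0Semigroup (reductionMatrix ι injective A)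

/-- A classical solution, on the whole line, of the abstract wave equation `u'' = A u`: a twice
continuously differentiable function with values in `D(A)` that satisfies the equation. -/
structure IsClassicalSolution (A : X →ₗ.[ℂ] X) (u : ℝ → X) : Prop where
  contDiff : ContDiff ℝ 2 u
  equation : ∀ t : ℝ, (u t, deriv (deriv u) t) ∈ A.graph

/-- The initial value problem `u'' = A u`, `u 0 = f`, `u' 0 = g` is well-posed in `V × X`:
for all data `f ∈ D(A)`, `g ∈ V` there is exactly one classical solution, these data are dense in
`V × X`, and classical solutions depend continuously on their data, uniformly for bounded times,
both in the norm of the phase space and in the norm of `X`. -/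
structure WellPosed (ι : V →L[ℂ] X) (A : X →ₗ.[ℂ] X) : Prop where
  existsUnique : ∀ f ∈ A.domain, ∀ g : V,
    ∃! u : ℝ → X, IsClassicalSolution A u ∧ u 0 = f ∧ deriv u 0 = ι g
  dense : Dense {p : V × X | ι p.1 ∈ A.domain ∧ p.2 ∈ range ι}
  domain_subset : ∀ f ∈ A.domain, f ∈ range ι
  phase_bound : ∀ τ : ℝ, ∃ M : ℝ, ∀ u : ℝ → X, IsClassicalSolution A u →
    ∀ t : ℝ, |t| ≤ τ → ∀ v₀ v : V, ι v₀ = u 0 → ι v = u t →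
      ‖v‖ + ‖deriv u t‖ ≤ M * (‖v₀‖ + ‖deriv u 0‖)
  norm_bound : ∀ τ : ℝ, ∃ M : ℝ, ∀ u : ℝ → X, IsClassicalSolution A u →
    ∀ t : ℝ, |t| ≤ τ → ‖u t‖ ≤ M * (‖u 0‖ + ‖deriv u 0‖)

end OneOperator

section Coupling

/-- For an operator `A` on `X`, a subspace `V` of `X` and a subspace `W` of `Y` (embedded by `ι`
and `κ`), the linear map `B : D(A) → Y` is bounded from `[D(A)]` to `W`, or it is (the restriction
to `D(A)` of) a bounded operator from `V` to `Y`. -/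
def AdmissibleCoupling {V X W Y : Type*}
    [NormedAddCommGroup V] [NormedSpace ℂ V] [NormedAddCommGroup X] [NormedSpace ℂ X]
    [NormedAddCommGroup W] [NormedSpace ℂ W] [NormedAddCommGroup Y] [NormedSpace ℂ Y]
    (ι : V →L[ℂ] X) (κ : W →L[ℂ] Y) (A : X →ₗ.[ℂ] X) (B : A.domain →ₗ[ℂ] Y) : Prop :=
  (∃ T : A.domain →ₗ[ℂ] W, GraphBounded A T ∧ ∀ x : A.domain, κ (T x) = B x) ∨
  (∃ T : V →L[ℂ] Y, ∀ (x : A.domain) (v : V), ι v = x → T v = B x)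

variable {n : ℕ} {X : Fin n → Type*}
  [∀ i, NormedAddCommGroup (X i)] [∀ i, NormedSpace ℂ (X i)]

/-- The operator matrix of the coupled system, on `∏ X_i` with the diagonal domain `∏ D(A_i)`:
its `i`-th component is `A_i x_i + ∑_{k > i} B^i_k x_k + ∑_{h < i} C^i_h x_h`. Only the entries
`B i k` with `i < k` and `C i h` with `h < i` are used. -/
def coupledOperator (A : ∀ i, X i →ₗ.[ℂ] X i)
    (B C : ∀ i j : Fin n, (A j).domain →ₗ[ℂ] X i) : (∀ i, X i) →ₗ.[ℂ] (∀ i, X i) where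
  domain := Submodule.pi Set.univ fun i => (A i).domain
  toFun :=
    { toFun := fun x i =>
        A i ⟨x.1 i, x.2 i trivial⟩
          + ∑ k ∈ Finset.Ioi i, B i k ⟨x.1 k, x.2 k trivial⟩
          + ∑ h ∈ Finset.Iio i, C i h ⟨x.1 h, x.2 h trivial⟩
      map_add' := by
        intro x y
        funext i
        have hA : A i ⟨(x + y).1 i, (x + y).2 i trivial⟩
            = A i ⟨x.1 i, x.2 i trivial⟩ + A i ⟨y.1 i, y.2 i trivial⟩ :=
          LinearPMap.map_add (A i) ⟨x.1 i, x.2 i trivial⟩ ⟨y.1 i, y.2 i trivial⟩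
        have hK : ∀ (K : ∀ i j : Fin n, (A j).domain →ₗ[ℂ] X i) (k : Fin n),
            K i k ⟨(x + y).1 k, (x + y).2 k trivial⟩
              = K i k ⟨x.1 k, x.2 k trivial⟩ + K i k ⟨y.1 k, y.2 k trivial⟩ := fun K k =>
          map_add (K i k) ⟨x.1 k, x.2 k trivial⟩ ⟨y.1 k, y.2 k trivial⟩
        simp only [Pi.add_apply, hA, hK, Finset.sum_add_distrib]
        abel
      map_smul' := by
        intro c x
        funext i
        have hA : A i ⟨(c • x).1 i, (c • x).2 i trivial⟩ = c • A i ⟨x.1 i, x.2 i trivial⟩ :=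
          LinearPMap.map_smul (A i) c ⟨x.1 i, x.2 i trivial⟩
        have hK : ∀ (K : ∀ i j : Fin n, (A j).domain →ₗ[ℂ] X i) (k : Fin n),
            K i k ⟨(c • x).1 k, (c • x).2 k trivial⟩
              = c • K i k ⟨x.1 k, x.2 k trivial⟩ := fun K k =>
          map_smul (K i k) c ⟨x.1 k, x.2 k trivial⟩
        simp only [Pi.smul_apply, RingHom.id_apply, hA, hK, Finset.smul_sum, smul_add] }

end Coupling

end CosineSystem

end

/-! Everything reduces to the operator matrix `(0, I; A, 0)` on `V × X`. If it generates a
C₀-semigroup and `D(A) ⊆ V`, the rest follows. The reflection `(v, x) ↦ (v, -x)` conjugates the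
matrix to its negative, so the semigroup extends to a group `U`. The second component of `U t (0,
x)` is the cosine function, the resolvent of the matrix yields one of `A` with values in `V` (hence
closedness and `[D(A)] ↪ V`), and classical solutions are orbits of `U`.

For uncoupled equations the matrix on the product generates the product semigroup. Each coupling is
the sum of a part bounded from `[D(A)]` to `V` and a part bounded from `V` to `X`. In the matrix,
the second part is a bounded perturbation of `V × X`. The first sends `(v, x)` to a vector of `0 ×
V`, which lies in the domain of the matrix, and is bounded there for the graph norm. Such
perturbations preserve generation: with `R = (l - G)⁻¹` and `l` large, `W = 1 - K R` is invertible
and conjugates `G + (l - G) K R`, a bounded perturbation of `G`, to `G + K`.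

The main lemmas are `IsC0Semigroup.exists_perturb_graphBounded`,
`generatesC0Semigroup_reductionMatrix_perturb`, `generatesCOFWithPhaseSpace_of_reduction` and
`wellPosed_of_reduction`. -/

noncomputable section

namespace CosineSystem

/-! ### C₀-semigroups: growth, generator, resolvent. -/

section Semigroup

variable {E F : Type*} [NormedAddCommGroup E] [NormedSpace ℂ E]
  [NormedAddCommGroup F] [NormedSpace ℂ F]

/-- The generator of `T`, as a relation: `y = lim_{t → 0+} (T(t)x - x) / t`. -/
def Gen (T : ℝ → E →L[ℂ] E) (x y : E) : Prop :=
  Tendsto (fun t : ℝ => t⁻¹ • (T t x - x)) (𝓝[>] 0) (𝓝 y)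

theorem Gen.add {T : ℝ → E →L[ℂ] E} {x y x' y' : E} (h : Gen T x y) (h' : Gen T x' y') :
    Gen T (x + x') (y + y') := by
  refine (Tendsto.add h h').congr fun t => ?_
  rw [map_add, ← smul_add]
  congr 1
  abel

theorem Gen.smul {T : ℝ → E →L[ℂ] E} {x y : E} (c : ℂ) (h : Gen T x y) :
    Gen T (c • x) (c • y) := by
  refine (Tendsto.const_smul h c).congr fun t => ?_
  rw [map_smul, ← smul_sub, smul_comm]

theorem Gen.neg {T : ℝ → E →L[ℂ] E} {x y : E} (h : Gen T x y) : Gen T (-x) (-y) := by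
  simpa using h.smul (-1)

theorem Gen.sub {T : ℝ → E →L[ℂ] E} {x y x' y' : E} (h : Gen T x y) (h' : Gen T x' y') :
    Gen T (x - x') (y - y') := by
  simpa [sub_eq_add_neg] using h.add h'.neg

/-- By Banach–Steinhaus the operators are uniformly bounded, hence equi-Lipschitz, for `t` near a
given time; strong continuity in `t` then gives joint continuity. -/
theorem continuous_apply_prod [CompleteSpace E] {L : ℝ → E →L[ℂ] F}
    (hL : ∀ x, Continuous fun t => L t x) : Continuous fun p : ℝ × E => L p.1 p.2 := by
  rw [continuous_iff_continuousAt]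
  rintro ⟨a, x⟩
  obtain ⟨M, hM⟩ : ∃ M, ∀ t : Icc (a - 1) (a + 1), ‖L t‖ ≤ M := by
    refine banach_steinhaus fun x => ?_
    obtain ⟨c, hc⟩ := isCompact_Icc.exists_bound_of_continuousOn
      (s := Icc (a - 1) (a + 1)) (hL x).continuousOn
    exact ⟨c, fun t => hc t t.2⟩
  have key : ContinuousOn (fun p : ℝ × E => L p.1 p.2) (Icc (a - 1) (a + 1) ×ˢ univ) := by
    refine continuousOn_prod_of_continuousOn_lipschitzOnWith' _ (Real.toNNReal M) (fun t ht => ?_)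
      fun y _ => (hL y).continuousOn
    refine ((L t).lipschitz.weaken ?_).lipschitzOnWith
    exact NNReal.le_toNNReal_of_coe_le (hM ⟨t, ht⟩)
  exact key.continuousAt (prod_mem_nhds (Icc_mem_nhds (by linarith) (by linarith)) univ_mem)

theorem exists_norm_le_of_continuous [CompleteSpace E] {L : ℝ → E →L[ℂ] F}
    (hL : ∀ x, Continuous fun t => L t x) (a b : ℝ) : ∃ M, ∀ t ∈ Icc a b, ‖L t‖ ≤ M := by
  obtain ⟨M, hM⟩ : ∃ M, ∀ t : Icc a b, ‖L t‖ ≤ M := by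
    refine banach_steinhaus fun x => ?_
    obtain ⟨c, hc⟩ := isCompact_Icc.exists_bound_of_continuousOn
      (s := Icc a b) (hL x).continuousOn
    exact ⟨c, fun t => hc t t.2⟩
  exact ⟨M, fun t ht => hM ⟨t, ht⟩⟩

/-- Product rule for a strongly continuous operator family acting on a differentiable function. -/
theorem hasDerivAt_apply [CompleteSpace E] {L : ℝ → E →L[ℂ] F}
    (hL : ∀ x, Continuous fun t => L t x) {z : ℝ → E} {z' : E} {d : F} {s : ℝ}
    (hz : HasDerivAt z z' s) (hd : HasDerivAt (fun r => L r (z s)) d s) :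
    HasDerivAt (fun r => L r (z r)) (L s z' + d) s := by
  rw [hasDerivAt_iff_tendsto_slope] at hz hd ⊢
  have h1 : Tendsto (fun r => L r (slope z s r)) (𝓝[≠] s) (𝓝 (L s z')) := by
    have hc := (continuous_apply_prod hL).tendsto (s, z')
    exact hc.comp ((tendsto_nhdsWithin_of_tendsto_nhds tendsto_id).prodMk_nhds hz)
  refine (h1.add hd).congr fun r => ?_
  simp only [slope_def_module]
  have : L r ((r - s)⁻¹ • (z r - z s)) = (r - s)⁻¹ • L r (z r - z s) :=
    ((L r).restrictScalars ℝ).map_smul _ _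
  rw [this, ← smul_add, map_sub]
  congr 1
  abel

variable {T : ℝ → E →L[ℂ] E}

theorem IsC0Semigroup.map_add_apply (hT : IsC0Semigroup T) {s t : ℝ} (hs : 0 ≤ s) (ht : 0 ≤ t)
    (x : E) : T (s + t) x = T s (T t x) := by rw [hT.map_add s t hs ht]; rfl

theorem IsC0Semigroup.commute (hT : IsC0Semigroup T) {s t : ℝ} (hs : 0 ≤ s) (ht : 0 ≤ t)
    (x : E) : T s (T t x) = T t (T s x) := by
  rw [← hT.map_add_apply hs ht, add_comm, hT.map_add_apply ht hs]

theorem IsC0Semigroup.zero_apply (hT : IsC0Semigroup T) (x : E) : T 0 x = x := by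
  rw [hT.map_zero]; rfl

/-- Values of `T` at negative times are arbitrary. Replacing `t` by `max t 0` gives a family
strongly continuous on the whole line, to which integrals and derivatives apply. -/
theorem IsC0Semigroup.continuous_max (hT : IsC0Semigroup T) (x : E) :
    Continuous fun t => T (max t 0) x :=
  (hT.continuousOn x).comp_continuous (by fun_prop) fun t => le_max_right t 0

theorem IsC0Semigroup.exists_exp_bound [CompleteSpace E] (hT : IsC0Semigroup T) :
    ∃ M ω : ℝ, 1 ≤ M ∧ 0 ≤ ω ∧ ∀ t, 0 ≤ t → ‖T t‖ ≤ M * Real.exp (ω * t) := by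
  obtain ⟨M₀, hM₀⟩ := exists_norm_le_of_continuous hT.continuous_max 0 1
  set M := max M₀ 1
  have hM1 : 1 ≤ M := le_max_right _ _
  have hM : ∀ t, 0 ≤ t → t ≤ 1 → ‖T t‖ ≤ M := fun t h0 h1 => by
    have := hM₀ t ⟨h0, h1⟩
    rw [max_eq_left h0] at this
    exact this.trans (le_max_left _ _)
  have hpow : ∀ (k : ℕ) (t : ℝ), 0 ≤ t → t ≤ 1 → ‖T (t + k)‖ ≤ M * M ^ k := by
    intro k
    induction k with
    | zero => intro t h0 h1; simpa using hM t h0 h1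
    | succ k ih =>
      intro t h0 h1
      have : t + ((k + 1 : ℕ) : ℝ) = (t + k) + 1 := by push_cast; ring
      rw [this, hT.map_add _ _ (by positivity) zero_le_one, pow_succ, ← mul_assoc]
      refine (norm_mul_le _ _).trans ?_
      exact mul_le_mul (ih t h0 h1) (hM 1 zero_le_one le_rfl) (norm_nonneg _) (by positivity)
  -- Split `t` into fractional part and floor: `M ^ ⌊t⌋₊ ≤ M ^ t = exp (t log M)`, using `1 ≤ M`.
  refine ⟨M, Real.log M, hM1, Real.log_nonneg hM1, fun t ht => ?_⟩
  have h1 := hpow ⌊t⌋₊ (t - ⌊t⌋₊) (sub_nonneg.2 (Nat.floor_le ht))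
    (by linarith [Nat.lt_floor_add_one t])
  rw [sub_add_cancel] at h1
  refine h1.trans (mul_le_mul_of_nonneg_left ?_ (by positivity))
  rw [← Real.rpow_def_of_pos (by positivity), ← Real.rpow_natCast]
  exact Real.rpow_le_rpow_of_exponent_le hM1 (Nat.floor_le ht)

/-- Right difference quotients of an orbit. -/
theorem IsC0Semigroup.hasDerivWithinAt (hT : IsC0Semigroup T) {x y : E} (h : Gen T x y) {t : ℝ}
    (ht : 0 ≤ t) : HasDerivWithinAt (fun r => T (max r 0) x) (T t y) (Ioi t) t := by
  rw [hasDerivWithinAt_iff_tendsto_slope' (by simp)]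
  have h1 : Tendsto (fun r => r - t) (𝓝[>] t) (𝓝[>] 0) := by
    refine tendsto_nhdsWithin_iff.2 ⟨?_, ?_⟩
    · have : Tendsto (fun r => r - t) (𝓝 t) (𝓝 (t - t)) := by
        exact (continuous_id.sub continuous_const).tendsto t
      rw [sub_self] at this
      exact this.mono_left nhdsWithin_le_nhds
    · filter_upwards [self_mem_nhdsWithin] with r hr
      exact sub_pos.2 (mem_Ioi.1 hr)
  have h2 := ((T t).continuous.tendsto y).comp (Tendsto.comp h h1)
  refine h2.congr' ?_
  filter_upwards [self_mem_nhdsWithin] with r hr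
  have hr : t < r := hr
  have h3 : T (max r 0) x = T t (T (r - t) x) := by
    rw [max_eq_left (by linarith), ← hT.map_add_apply ht (by linarith)]
    congr 2
    ring
  have h4 : ∀ (c : ℝ) (z : E), T t (c • z) = c • T t z :=
    fun c z => ((T t).restrictScalars ℝ).map_smul _ _
  simp only [Function.comp_apply, slope_def_module, h4, h3, max_eq_left ht, map_sub]

theorem IsC0Semigroup.gen_apply (hT : IsC0Semigroup T) {x y : E} (h : Gen T x y) {t : ℝ}
    (ht : 0 ≤ t) : Gen T (T t x) (T t y) := by
  refine (((T t).continuous.tendsto y).comp h).congr' ?_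
  filter_upwards [self_mem_nhdsWithin] with r hr
  have h4 : ∀ (c : ℝ) (z : E), T t (c • z) = c • T t z :=
    fun c z => ((T t).restrictScalars ℝ).map_smul _ _
  rw [Function.comp_apply, h4, map_sub, hT.commute ht (le_of_lt hr)]

/-- The semigroup `e^{at} T(t)`. -/
def rescale (a : ℝ) (T : ℝ → E →L[ℂ] E) (t : ℝ) : E →L[ℂ] E := ((Real.exp (a * t) : ℝ) : ℂ) • T t

theorem rescale_apply (a : ℝ) (T : ℝ → E →L[ℂ] E) (t : ℝ) (x : E) :
    rescale a T t x = Real.exp (a * t) • T t x := by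
  simp only [rescale, smul_apply, Complex.coe_smul]

theorem norm_rescale (a : ℝ) (T : ℝ → E →L[ℂ] E) (t : ℝ) :
    ‖rescale a T t‖ = Real.exp (a * t) * ‖T t‖ := by
  rw [rescale, norm_smul, Complex.norm_real, Real.norm_of_nonneg (Real.exp_pos _).le]

theorem IsC0Semigroup.rescale (hT : IsC0Semigroup T) (a : ℝ) : IsC0Semigroup (rescale a T) where
  map_zero := by simp [CosineSystem.rescale, hT.map_zero]
  map_add s t hs ht := by
    simp only [CosineSystem.rescale, hT.map_add s t hs ht, mul_add, Real.exp_add,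
      Complex.ofReal_mul, smul_mul_smul_comm]
  continuousOn x := by
    simp only [rescale_apply]
    have : Continuous fun t : ℝ => Real.exp (a * t) := by fun_prop
    exact this.continuousOn.smul (hT.continuousOn x)

theorem Gen.rescale (a : ℝ) {x y : E} (h : Gen T x y) :
    Gen (CosineSystem.rescale a T) x (y + a • x) := by
  have h1 : HasDerivAt (fun t : ℝ => Real.exp (a * t)) a 0 := by
    simpa using ((hasDerivAt_id (0 : ℝ)).const_mul a).exp
  have h2 := h1.tendsto_slope_zero_right
  simp only [zero_add, mul_zero, Real.exp_zero] at h2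
  have h3 : Tendsto (fun t : ℝ => Real.exp (a * t)) (𝓝[>] 0) (𝓝 1) := by
    have : Continuous fun t : ℝ => Real.exp (a * t) := by fun_prop
    simpa using (this.tendsto 0).mono_left nhdsWithin_le_nhds
  have h4 := (h3.smul h).add (h2.smul_const x)
  rw [one_smul] at h4
  refine h4.congr fun t => ?_
  rw [rescale_apply]
  simp only [smul_eq_mul, mul_smul, smul_comm (Real.exp (a * t)) t⁻¹, smul_sub,
    sub_smul, one_smul]
  abel

theorem rescale_rescale (a b : ℝ) (T : ℝ → E →L[ℂ] E) :
    rescale a (rescale b T) = rescale (a + b) T := by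
  funext t
  simp only [rescale, smul_smul, ← Complex.ofReal_mul, ← Real.exp_add, add_mul]

theorem rescale_zero (T : ℝ → E →L[ℂ] E) : rescale 0 T = T := by
  funext t
  simp [rescale]

theorem gen_rescale_iff (a : ℝ) {x y : E} :
    Gen (CosineSystem.rescale a T) x y ↔ Gen T x (y - a • x) := by
  refine ⟨fun h => ?_, fun h => by simpa using h.rescale a⟩
  have := h.rescale (-a)
  rwa [rescale_rescale, neg_add_cancel, rescale_zero, neg_smul, ← sub_eq_add_neg] at this

variable [CompleteSpace E]

theorem IsC0Semigroup.integral_gen (hT : IsC0Semigroup T) {x y : E} (h : Gen T x y) {t : ℝ}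
    (ht : 0 ≤ t) : ∫ s in (0 : ℝ)..t, T (max s 0) y = T t x - x := by
  have := intervalIntegral.integral_eq_sub_of_hasDeriv_right_of_le ht
    (hT.continuous_max x).continuousOn (f' := fun r => T (max r 0) y)
    (fun r hr => by
      have := hT.hasDerivWithinAt h hr.1.le
      simpa only [max_eq_left hr.1.le] using this)
    ((hT.continuous_max y).intervalIntegrable _ _)
  rw [this, max_eq_left ht, max_self, hT.zero_apply]

theorem IsC0Semigroup.hasDerivAt (hT : IsC0Semigroup T) {x y : E} (h : Gen T x y) {t : ℝ}
    (ht : 0 < t) : HasDerivAt (fun r => T (max r 0) x) (T t y) t := by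
  have h1 : HasDerivAt (fun r => x + ∫ s in (0 : ℝ)..r, T (max s 0) y) (T (max t 0) y) t :=
    ((hT.continuous_max y).integral_hasStrictDerivAt 0 t).hasDerivAt.const_add x
  rw [max_eq_left ht.le] at h1
  refine h1.congr_of_eventuallyEq ?_
  filter_upwards [lt_mem_nhds ht] with r hr
  rw [hT.integral_gen h hr.le, max_eq_left hr.le]
  abel

theorem IsC0Semigroup.gen_integral (hT : IsC0Semigroup T) (x : E) {t : ℝ} (ht : 0 ≤ t) :
    Gen T (∫ s in (0 : ℝ)..t, T (max s 0) x) (T t x - x) := by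
  set f : ℝ → E := fun s => T (max s 0) x with hf
  have hc : Continuous f := hT.continuous_max x
  have hi : ∀ a b, IntervalIntegrable f MeasureTheory.volume a b :=
    fun a b => hc.intervalIntegrable a b
  set Φ : ℝ → E := fun r => ∫ s in (0 : ℝ)..r, f s with hΦ
  have hd : ∀ r, HasDerivAt Φ (f r) r := fun r =>
    (hc.integral_hasStrictDerivAt 0 r).hasDerivAt
  have h1 : HasDerivAt (fun h => Φ (h + t) - Φ h) (f t - f 0) 0 := by
    have := (hd (0 + t)).comp_add_const 0 t
    rw [zero_add] at this
    exact this.sub (hd 0)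
  have h2 := h1.tendsto_slope_zero_right
  have hft : f t - f 0 = T t x - x := by simp [hf, max_eq_left ht, hT.zero_apply]
  rw [hft] at h2
  refine h2.congr' ?_
  filter_upwards [self_mem_nhdsWithin] with h hh
  have hh : 0 < h := hh
  have h3 : T h (Φ t) = Φ (h + t) - Φ h := by
    have e1 : T h (Φ t) = ∫ s in (0 : ℝ)..t, T h (f s) :=
      ((T h).intervalIntegral_comp_comm (hi 0 t)).symm
    have e2 : ∫ s in (0 : ℝ)..t, T h (f s) = ∫ s in (0 : ℝ)..t, f (h + s) := by
      refine intervalIntegral.integral_congr fun s hs => ?_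
      rw [uIcc_of_le ht] at hs
      simp only [hf]
      rw [max_eq_left hs.1, max_eq_left (by linarith [hs.1]), hT.map_add_apply hh.le hs.1]
    rw [e1, e2, intervalIntegral.integral_comp_add_left, add_zero, hΦ]
    exact (intervalIntegral.integral_interval_sub_left (hi _ _) (hi _ _)).symm
  change _ = h⁻¹ • (T h (Φ t) - Φ t)
  rw [h3]
  simp [hΦ]

/-- The averages `t⁻¹ ∫₀ᵗ T(s) x ds` lie in the domain of the generator and tend to `x`. -/
theorem IsC0Semigroup.dense_domain (hT : IsC0Semigroup T) : Dense {x : E | ∃ y, Gen T x y} := by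
  intro x
  have hc := hT.continuous_max x
  have h1 := (hc.integral_hasStrictDerivAt 0 0).hasDerivAt.tendsto_slope_zero_right
  simp only [max_self, hT.zero_apply, zero_add, intervalIntegral.integral_same, sub_zero] at h1
  refine mem_closure_of_tendsto h1 ?_
  filter_upwards [self_mem_nhdsWithin] with t ht
  have := (hT.gen_integral x (le_of_lt ht)).smul ((t⁻¹ : ℝ) : ℂ)
  exact ⟨_, by simpa only [Complex.coe_smul] using this⟩

/-- The resolvent `(l - A)⁻¹` of the generator, for all large `l`, with norm `O(1 / l)`. -/
theorem IsC0Semigroup.exists_resolvent (hT : IsC0Semigroup T) :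
    ∃ l₀ c : ℝ, ∀ l : ℝ, l₀ ≤ l → 0 < l → ∃ R : E →L[ℂ] E, ‖R‖ ≤ c / l ∧
      ∀ x y, Gen T x y ↔ x = R (l • x - y) := by
  obtain ⟨M, hM⟩ := exists_norm_le_of_continuous hT.continuous_max 0 1
  have hM' : ∀ t, 0 ≤ t → t ≤ 1 → ‖T t‖ ≤ M := fun t h0 h1 => by
    simpa [max_eq_left h0] using hM t ⟨h0, h1⟩
  have hM0 : 0 ≤ M := (norm_nonneg _).trans (hM' 0 le_rfl zero_le_one)
  -- This threshold makes `‖S 1‖ ≤ 1 / 2` for `S t = exp (-l t) T t`.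
  have hev : ∀ᶠ l : ℝ in atTop, Real.exp (-l * 1) * M ≤ 1 / 2 := by
    have : Tendsto (fun l : ℝ => Real.exp (-l * 1) * M) atTop (𝓝 (0 * M)) := by
      simp only [mul_one]
      exact Real.tendsto_exp_neg_atTop_nhds_zero.mul_const M
    rw [zero_mul] at this
    exact this.eventually_le_const (by norm_num)
  obtain ⟨l₀, hl₀⟩ := eventually_atTop.1 hev
  refine ⟨l₀, M * 2, fun l hl hl0 => ?_⟩
  set S := CosineSystem.rescale (-l) T with hS
  have hS0 : IsC0Semigroup S := hT.rescale (-l)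
  have hS1 : ‖S 1‖ ≤ 1 / 2 := by
    rw [hS, norm_rescale]
    exact (mul_le_mul_of_nonneg_left (hM' 1 zero_le_one le_rfl) (Real.exp_pos _).le).trans
      (hl₀ l hl)
  have hJb : ∀ x, ‖∫ s in (0 : ℝ)..1, S (max s 0) x‖ ≤ M / l * ‖x‖ := by
    intro x
    have h1 : ‖∫ s in (0 : ℝ)..1, S (max s 0) x‖ ≤
        ∫ s in (0 : ℝ)..1, Real.exp (-l * s) * (M * ‖x‖) := by
      refine intervalIntegral.norm_integral_le_of_norm_le zero_le_one ?_
        ((by fun_prop : Continuous fun s : ℝ => Real.exp (-l * s) * (M * ‖x‖)).intervalIntegrable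
          _ _)
      refine Filter.Eventually.of_forall fun s hs => ?_
      rw [max_eq_left hs.1.le]
      refine ((S s).le_opNorm x).trans ?_
      rw [hS, norm_rescale, mul_assoc]
      have := hM' s hs.1.le hs.2
      gcongr
    refine h1.trans ?_
    rw [intervalIntegral.integral_mul_const, intervalIntegral.integral_comp_mul_left
      (fun s => Real.exp s) (neg_ne_zero.2 hl0.ne'), integral_exp]
    simp only [mul_one, mul_zero, Real.exp_zero, smul_eq_mul]
    have h2 : (-l)⁻¹ * (Real.exp (-l) - 1) ≤ 1 / l := by
      rw [inv_neg, neg_mul, ← mul_neg, neg_sub, ← div_eq_inv_mul]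
      gcongr
      linarith [Real.exp_pos (-l)]
    calc (-l)⁻¹ * (Real.exp (-l) - 1) * (M * ‖x‖) ≤ 1 / l * (M * ‖x‖) := by gcongr
      _ = M / l * ‖x‖ := by ring
  have hint : ∀ x, IntervalIntegrable (fun s => S (max s 0) x) MeasureTheory.volume 0 1 :=
    fun x => (hS0.continuous_max x).intervalIntegrable _ _
  -- Integrating over `[0, 1]` suffices: the generator of `S`, which is that of `T` minus `l`, sends
  -- `J x` to `S 1 x - x`. Hence `J (1 - S 1)⁻¹` is the resolvent, with norm at most `(M / l) * 2`.
  let J : E →L[ℂ] E := LinearMap.mkContinuous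
    { toFun := fun x => ∫ s in (0 : ℝ)..1, S (max s 0) x
      map_add' := fun x y => by
        simp_rw [_root_.map_add]
        exact intervalIntegral.integral_add (hint x) (hint y)
      map_smul' := fun c x => by
        simp_rw [map_smul, RingHom.id_apply]
        exact intervalIntegral.integral_smul _ _ } (M / l) hJb
  have hJ : ∀ x, Gen S (J x) (S 1 x - x) := fun x => hS0.gen_integral x zero_le_one
  have hJn : ‖J‖ ≤ M / l := LinearMap.mkContinuous_norm_le _ (by positivity) _
  let Q : (E →L[ℂ] E)ˣ := Units.oneSub (S 1) (hS1.trans_lt (by norm_num))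
  have hQ1 : ∀ x, (Q⁻¹ : (E →L[ℂ] E)ˣ).val x - S 1 ((Q⁻¹ : (E →L[ℂ] E)ˣ).val x) = x := fun x => by
    have := congrArg (fun L : E →L[ℂ] E => L x) Q.mul_inv
    simpa [Q] using this
  have hQn : ‖(Q⁻¹ : (E →L[ℂ] E)ˣ).val‖ ≤ 2 := by
    refine ContinuousLinearMap.opNorm_le_bound _ (by norm_num) fun x => ?_
    have h1 := hQ1 x
    set z := (Q⁻¹ : (E →L[ℂ] E)ˣ).val x
    have h2 : ‖S 1 z‖ ≤ 1 / 2 * ‖z‖ := ((S 1).le_opNorm z).trans (by gcongr)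
    have h3 : ‖z‖ ≤ ‖x‖ + ‖S 1 z‖ := by
      calc ‖z‖ = ‖x + S 1 z‖ := by rw [← h1]; congr 1; abel
        _ ≤ _ := norm_add_le _ _
    linarith
  -- A vector killed by the generator is fixed by `S 1`, whose norm is at most `1 / 2`.
  have hinj : ∀ x, Gen S x 0 → x = 0 := by
    intro x hx
    have h1 := hS0.integral_gen hx zero_le_one
    simp_rw [_root_.map_zero, intervalIntegral.integral_zero] at h1
    have h2 : ‖S 1 x‖ ≤ 1 / 2 * ‖x‖ := ((S 1).le_opNorm x).trans (by gcongr)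
    rw [sub_eq_zero.1 h1.symm] at h2
    have := norm_nonneg x
    exact norm_eq_zero.1 (by linarith)
  refine ⟨J * (Q⁻¹ : (E →L[ℂ] E)ˣ).val, ?_, fun x y => ?_⟩
  · calc _ ≤ ‖J‖ * ‖(Q⁻¹ : (E →L[ℂ] E)ˣ).val‖ := norm_mul_le _ _
      _ ≤ M / l * 2 := by gcongr
      _ = _ := by ring
  have hR : ∀ z, Gen S ((J * (Q⁻¹ : (E →L[ℂ] E)ˣ).val) z) (-z) := fun z => by
    have := hJ ((Q⁻¹ : (E →L[ℂ] E)ˣ).val z)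
    rwa [← neg_sub, hQ1] at this
  have hST : Gen T x y ↔ Gen S x (y - l • x) := by
    rw [hS, gen_rescale_iff, neg_smul, sub_neg_eq_add, sub_add_cancel]
  rw [hST]
  constructor
  · intro h
    have := h.sub (hR (l • x - y))
    rw [neg_sub, sub_self] at this
    exact sub_eq_zero.1 (hinj _ this)
  · intro h
    have := hR (l • x - y)
    rwa [← h, neg_sub] at this

end Semigroup

/-! ### Perturbation of generators. -/

section Perturbation

open scoped BoundedContinuousFunction

variable {E F : Type*} [NormedAddCommGroup E] [NormedSpace ℂ E]
  [NormedAddCommGroup F] [NormedSpace ℂ F] {T : ℝ → E →L[ℂ] E}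

theorem tendsto_inv_smul_integral [CompleteSpace E] {f : ℝ → ℝ → E} (hf : Continuous f.uncurry) :
    Tendsto (fun t : ℝ => t⁻¹ • ∫ s in (0 : ℝ)..t, f t s) (𝓝[>] 0) (𝓝 (f 0 0)) := by
  rw [Metric.tendsto_nhds]
  intro ε hε
  have h0 := Metric.continuous_iff.1 hf (0, 0) (ε / 2) (half_pos hε)
  obtain ⟨δ, hδ, h⟩ := h0
  filter_upwards [Ioo_mem_nhdsGT hδ] with t ht
  have hi : IntervalIntegrable (f t) MeasureTheory.volume 0 t :=
    (hf.comp (by fun_prop : Continuous fun s => (t, s))).intervalIntegrable _ _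
  have h1 : ‖∫ s in (0 : ℝ)..t, (f t s - f 0 0)‖ ≤ ε / 2 * |t - 0| := by
    refine intervalIntegral.norm_integral_le_of_norm_le_const fun s hs => ?_
    rw [uIoc_of_le ht.1.le] at hs
    have := h (t, s) (by
      rw [Prod.dist_eq]
      exact max_lt (by simpa [abs_of_pos ht.1] using ht.2)
        (by simpa [abs_of_pos hs.1] using hs.2.trans_lt ht.2))
    rw [← dist_eq_norm]
    exact this.le
  rw [intervalIntegral.integral_sub hi (by simp), intervalIntegral.integral_const, sub_zero,
    abs_of_pos ht.1] at h1
  have h2 : t⁻¹ • (∫ s in (0 : ℝ)..t, f t s) - f 0 0 =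
      t⁻¹ • ((∫ s in (0 : ℝ)..t, f t s) - t • f 0 0) := by
    rw [smul_sub, inv_smul_smul₀ ht.1.ne']
  rw [dist_eq_norm, h2, norm_smul, norm_inv, Real.norm_of_nonneg ht.1.le]
  have h3 := mul_le_mul_of_nonneg_left h1 (inv_nonneg.2 ht.1.le)
  have h4 : t⁻¹ * (ε / 2 * t) = ε / 2 := by
    field_simp [ht.1.ne']
  linarith

/-- Similar semigroups. -/
theorem IsC0Semigroup.conj (hT : IsC0Semigroup T) (Φ : E ≃L[ℂ] F) :
    IsC0Semigroup fun t => (Φ : E →L[ℂ] F) ∘L T t ∘L (Φ.symm : F →L[ℂ] E) where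
  map_zero := by ext x; simp [hT.map_zero]
  map_add s t hs ht := by ext x; simp [hT.map_add s t hs ht]
  continuousOn x := Φ.continuous.comp_continuousOn (hT.continuousOn (Φ.symm x))

theorem gen_conj_iff (Φ : E ≃L[ℂ] F) {x y : F} :
    Gen (fun t => (Φ : E →L[ℂ] F) ∘L T t ∘L (Φ.symm : F →L[ℂ] E)) x y ↔
      Gen T (Φ.symm x) (Φ.symm y) := by
  have hs : ∀ (c : ℝ) (z : E), Φ (c • z) = c • Φ z := fun c z =>
    ((Φ : E →L[ℂ] F).restrictScalars ℝ).map_smul c z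
  have hs' : ∀ (c : ℝ) (z : F), Φ.symm (c • z) = c • Φ.symm z := fun c z =>
    ((Φ.symm : F →L[ℂ] E).restrictScalars ℝ).map_smul c z
  constructor
  · intro h
    refine ((Φ.symm.continuous.tendsto y).comp h).congr fun t => ?_
    simp [hs']
  · intro h
    have := (Φ.continuous.tendsto _).comp h
    rw [Φ.apply_symm_apply] at this
    refine this.congr fun t => ?_
    simp [hs]

variable [CompleteSpace E]

/-- `S` solves the variation of constants formula `S(t)x = T(t)x + ∫₀ᵗ T(t-s) P S(s)x ds`. Decay of
`T` and smallness of `P` make the integral operator a contraction of the bounded continuous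
functions on the line, so a Neumann series solves it for all times at once. Uniqueness of the fixed
point gives the semigroup law, and the integral contributes `P x` to the difference quotient at `0`.
-/
theorem IsC0Semigroup.exists_perturb_of_decay (hT : IsC0Semigroup T) (P : E →L[ℂ] E) {M μ : ℝ}
    (hM : 0 ≤ M) (hμ : 0 < μ) (hb : ∀ t, 0 ≤ t → ‖T t‖ ≤ M * Real.exp (-μ * t))
    (hP : M * ‖P‖ / μ ≤ 1 / 2) :
    ∃ S : ℝ → E →L[ℂ] E, IsC0Semigroup S ∧ ∀ x y, Gen S x y ↔ Gen T x (y - P x) := by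
  have hb' : ∀ t, 0 ≤ t → ‖T t‖ ≤ M := fun t ht => (hb t ht).trans
    (mul_le_of_le_one_right hM (Real.exp_le_one_iff.2 (by nlinarith)))
  have hcont := continuous_apply_prod hT.continuous_max
  have hk : ∀ u : ℝ → E, Continuous u →
      Continuous (Function.uncurry fun t s => T (max (t - s) 0) (P (u s))) := fun u hu =>
    hcont.comp (f := fun p : ℝ × ℝ => (p.1 - p.2, P (u p.2))) (by fun_prop)
  have hki : ∀ u : ℝ → E, Continuous u → ∀ t a b,
      IntervalIntegrable (fun s => T (max (t - s) 0) (P (u s))) MeasureTheory.volume a b :=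
    fun u hu t a b => ((hk u hu).comp (by fun_prop : Continuous fun s => (t, s))).intervalIntegrable
      _ _
  -- the Volterra operator
  let φ : (ℝ → E) → ℝ → E := fun u t =>
    ∫ s in (0 : ℝ)..(max t 0), T (max (max t 0 - s) 0) (P (u s))
  have hφc : ∀ u, Continuous u → Continuous (φ u) := fun u hu => by
    have := intervalIntegral.continuous_parametric_intervalIntegral_of_continuous
      (μ := MeasureTheory.volume) (a₀ := 0) (hk u hu) continuous_id
    exact this.comp (by fun_prop : Continuous fun t : ℝ => max t 0)
  have hφb : ∀ u : ℝ →ᵇ E, ∀ t, ‖φ u t‖ ≤ 1 / 2 * ‖u‖ := by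
    intro u t
    set r := max t 0 with hr
    have hr0 : 0 ≤ r := le_max_right _ _
    have h1 : ‖φ u t‖ ≤ ∫ s in (0 : ℝ)..r, Real.exp (-μ * (r - s)) * (M * ‖P‖ * ‖u‖) := by
      refine intervalIntegral.norm_integral_le_of_norm_le hr0 ?_
        ((by fun_prop : Continuous fun s : ℝ =>
          Real.exp (-μ * (r - s)) * (M * ‖P‖ * ‖u‖)).intervalIntegrable _ _)
      refine Filter.Eventually.of_forall fun s hs => ?_
      have hs0 : 0 ≤ r - s := sub_nonneg.2 hs.2
      rw [max_eq_left hs0]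
      calc ‖T (r - s) (P (u s))‖ ≤ ‖T (r - s)‖ * (‖P‖ * ‖u s‖) :=
            ((T _).le_opNorm _).trans (by gcongr; exact P.le_opNorm _)
        _ ≤ (M * Real.exp (-μ * (r - s))) * (‖P‖ * ‖u‖) := by
            have := hb _ hs0
            have := u.norm_coe_le_norm s
            gcongr
        _ = _ := by ring
    refine h1.trans ?_
    rw [intervalIntegral.integral_mul_const,
      intervalIntegral.integral_comp_sub_left (fun s => Real.exp (-μ * s)),
      intervalIntegral.integral_comp_mul_left (fun s => Real.exp s) (neg_ne_zero.2 hμ.ne'),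
      integral_exp]
    simp only [sub_self, mul_zero, sub_zero, Real.exp_zero, smul_eq_mul]
    have h2 : (-μ)⁻¹ * (Real.exp (-μ * r) - 1) ≤ 1 / μ := by
      rw [inv_neg, neg_mul, ← mul_neg, neg_sub, ← div_eq_inv_mul]
      gcongr
      linarith [Real.exp_pos (-μ * r)]
    calc (-μ)⁻¹ * (Real.exp (-μ * r) - 1) * (M * ‖P‖ * ‖u‖) ≤ 1 / μ * (M * ‖P‖ * ‖u‖) := by gcongr
      _ = M * ‖P‖ / μ * ‖u‖ := by ring
      _ ≤ _ := by gcongr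
  let Φ : (ℝ →ᵇ E) →L[ℂ] (ℝ →ᵇ E) := LinearMap.mkContinuous
    { toFun := fun u => BoundedContinuousFunction.ofNormedAddCommGroup (φ u)
        (hφc u u.continuous) _ (hφb u)
      map_add' := fun u v => by
        ext t
        change φ (u + v : ℝ →ᵇ E) t = φ u t + φ v t
        simp only [φ, BoundedContinuousFunction.add_apply, _root_.map_add]
        exact intervalIntegral.integral_add (hki u u.continuous _ _ _) (hki v v.continuous _ _ _)
      map_smul' := fun c u => by
        ext t
        change φ (c • u : ℝ →ᵇ E) t = c • φ u t
        simp only [φ, BoundedContinuousFunction.smul_apply, _root_.map_smul]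
        exact intervalIntegral.integral_smul _ _ } (1 / 2)
    (fun u => BoundedContinuousFunction.norm_ofNormedAddCommGroup_le (hφc u u.continuous)
      (by positivity) (hφb u))
  have hΦn : ‖Φ‖ < 1 := (LinearMap.mkContinuous_norm_le _ (by norm_num) _).trans_lt (by norm_num)
  have hΦ : ∀ u t, Φ u t = φ u t := fun u t => rfl
  have hτb : ∀ x t, ‖T (max t 0) x‖ ≤ M * ‖x‖ := fun x t => by
    have := hb' _ (le_max_right t 0)
    exact ((T _).le_opNorm x).trans (by gcongr)
  let τ : E →L[ℂ] (ℝ →ᵇ E) := LinearMap.mkContinuous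
    { toFun := fun x => BoundedContinuousFunction.ofNormedAddCommGroup (fun t => T (max t 0) x)
        (hT.continuous_max x) (M * ‖x‖) (hτb x)
      map_add' := fun x y => by ext t; simp
      map_smul' := fun c x => by ext t; simp } M
    (fun x => BoundedContinuousFunction.norm_ofNormedAddCommGroup_le (hT.continuous_max x)
      (by positivity) (hτb x))
  have hτ : ∀ x t, τ x t = T (max t 0) x := fun u t => rfl
  let Q := Units.oneSub Φ hΦn
  let N : (ℝ →ᵇ E) →L[ℂ] (ℝ →ᵇ E) := (Q⁻¹ : ((ℝ →ᵇ E) →L[ℂ] (ℝ →ᵇ E))ˣ).val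
  have hN1 : ∀ u, N u = u + Φ (N u) := fun u => by
    have : N u - Φ (N u) = u := congrArg (fun L : (ℝ →ᵇ E) →L[ℂ] (ℝ →ᵇ E) => L u) Q.mul_inv
    exact sub_eq_iff_eq_add.1 this
  have hN2 : ∀ u w, w = u + Φ w → w = N u := fun u w h => by
    have h1 : N (w - Φ w) = w := congrArg (fun L : (ℝ →ᵇ E) →L[ℂ] (ℝ →ᵇ E) => L w) Q.inv_mul
    rw [← h1, sub_eq_iff_eq_add.2 h]
  let S : ℝ → E →L[ℂ] E := fun t =>
    (BoundedContinuousFunction.evalCLM ℂ t ∘L N) ∘L τ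
  have hS : ∀ t x, S t x = N (τ x) t := fun t x => rfl
  have hSV : ∀ x t, 0 ≤ t → S t x = T t x +
      ∫ s in (0 : ℝ)..t, T (max (t - s) 0) (P (S s x)) := by
    intro x t ht
    rw [hS, hN1, BoundedContinuousFunction.add_apply, hΦ, hτ]
    simp only [φ, max_eq_left ht, hS]
  have hSneg : ∀ x t, t ≤ 0 → S t x = x := by
    intro x t ht
    rw [hS, hN1, BoundedContinuousFunction.add_apply, hΦ, hτ]
    simp only [φ, max_eq_right ht, intervalIntegral.integral_same, hT.zero_apply, add_zero]
  have hSc : ∀ x, Continuous fun t => S t x := fun x => (N (τ x)).continuous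
  refine ⟨S, ⟨?_, ?_, fun x => (hSc x).continuousOn⟩, fun x y => ?_⟩
  · ext x
    exact hSneg x 0 le_rfl
  · intro r s hr hs
    ext x
    -- The orbit shifted by `s`, frozen at negative times like every function in the range of `τ`
    -- and `Φ`, solves the fixed point equation with initial value `S s x`.
    let w : ℝ →ᵇ E := (N (τ x)).compContinuous ⟨fun r => max r 0 + s, by fun_prop⟩
    have hw : ∀ r, w r = S (max r 0 + s) x := fun r => rfl
    have key : w = τ (S s x) + Φ w := by
      ext r
      rw [BoundedContinuousFunction.add_apply, hΦ, hτ, hw]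
      set q := max r 0 with hq
      have hq0 : 0 ≤ q := le_max_right _ _
      have hTS : ∀ z : E, ∀ p, 0 ≤ p → T q (T p z) = T (q + p) z := fun z p hp =>
        (hT.map_add_apply hq0 hp z).symm
      rw [hSV x (q + s) (by positivity), hSV x s hs, _root_.map_add, hTS _ _ hs, add_assoc]
      congr 1
      have hi := hki (fun s => S s x) (hSc x) (q + s)
      rw [← intervalIntegral.integral_add_adjacent_intervals (hi 0 s) (hi s (q + s)),
        ← (T q).intervalIntegral_comp_comm (hki (fun s => S s x) (hSc x) s 0 s)]
      congr 1
      · refine intervalIntegral.integral_congr fun p hp => ?_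
        rw [uIcc_of_le hs] at hp
        have : 0 ≤ s - p := sub_nonneg.2 hp.2
        rw [max_eq_left this, hTS _ _ this, max_eq_left (by linarith)]
        congr 2
        ring
      · have := intervalIntegral.integral_comp_add_right (a := 0) (b := q)
          (fun p => T (max (q + s - p) 0) (P (S p x))) s
        rw [zero_add] at this
        rw [← this]
        refine intervalIntegral.integral_congr fun p hp => ?_
        rw [uIcc_of_le hq0] at hp
        simp only [hw, max_eq_left hp.1]
        congr 3
        ring
    have := congrArg (fun f : ℝ →ᵇ E => f r) (hN2 _ _ key)
    simp only [hw, max_eq_left hr, ← hS] at this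
    exact this
  · have hI : Tendsto (fun t : ℝ => t⁻¹ • ∫ s in (0 : ℝ)..t, T (max (t - s) 0) (P (S s x)))
        (𝓝[>] 0) (𝓝 (P x)) := by
      have := tendsto_inv_smul_integral (hk _ (hSc x))
      simpa only [sub_self, max_self, hT.zero_apply, hSneg x 0 le_rfl] using this
    have hq : ∀ t, 0 < t → t⁻¹ • (S t x - x) = t⁻¹ • (T t x - x) +
        t⁻¹ • ∫ s in (0 : ℝ)..t, T (max (t - s) 0) (P (S s x)) := fun t ht => by
      rw [hSV x t ht.le, ← smul_add]
      congr 1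
      abel
    constructor
    · intro h
      refine (Tendsto.sub h hI).congr' ?_
      filter_upwards [self_mem_nhdsWithin] with t ht
      rw [hq t ht, add_sub_cancel_right]
    · intro h
      have := Tendsto.add h hI
      rw [sub_add_cancel] at this
      refine this.congr' ?_
      filter_upwards [self_mem_nhdsWithin] with t ht
      rw [hq t ht]

/-- The bounded perturbation theorem. -/
theorem IsC0Semigroup.exists_perturb (hT : IsC0Semigroup T) (P : E →L[ℂ] E) :
    ∃ S : ℝ → E →L[ℂ] E, IsC0Semigroup S ∧ ∀ x y, Gen S x y ↔ Gen T x (y - P x) := by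
  obtain ⟨M, ω, hM, hω, hb⟩ := hT.exists_exp_bound
  -- Chosen so that `M * ‖P‖ / μ ≤ 1 / 2`; rescaling by `-(ω + μ)` turns growth `ω` into decay `μ`.
  set μ := 2 * (M * ‖P‖) + 1 with hμ
  have hμ0 : 0 < μ := by positivity
  obtain ⟨S, hS, h⟩ := (hT.rescale (-(ω + μ))).exists_perturb_of_decay P (M := M) (by linarith)
    hμ0 (fun t ht => by
      rw [norm_rescale]
      calc _ ≤ Real.exp (-(ω + μ) * t) * (M * Real.exp (ω * t)) := by
            have := hb t ht
            gcongr
        _ = M * (Real.exp (-(ω + μ) * t) * Real.exp (ω * t)) := by ring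
        _ = _ := by
            rw [← Real.exp_add]
            congr 2
            ring)
    (by rw [div_le_iff₀ hμ0, hμ]; linarith)
  refine ⟨_, hS.rescale (ω + μ), fun x y => ?_⟩
  rw [gen_rescale_iff, h, gen_rescale_iff]
  congr! 1
  rw [neg_smul]
  abel

/-- If `c` inverts `1 - b a`, then `1 + a c b` inverts `1 - a b`. -/
theorem isUnit_one_sub_mul_swap {A : Type*} [Ring A] {a b : A} (h : IsUnit (1 - b * a)) :
    IsUnit (1 - a * b) := by
  obtain ⟨u, hu⟩ := h
  have h1 : (1 - b * a) * (u⁻¹ : Aˣ).val = 1 := by rw [← hu, Units.mul_inv]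
  have h2 : (u⁻¹ : Aˣ).val * (1 - b * a) = 1 := by rw [← hu, Units.inv_mul]
  set c := (u⁻¹ : Aˣ).val
  refine ⟨⟨1 - a * b, 1 + a * c * b, ?_, ?_⟩, rfl⟩
  · calc (1 - a * b) * (1 + a * c * b) = 1 - a * b + a * ((1 - b * a) * c) * b := by noncomm_ring
      _ = 1 := by rw [h1]; noncomm_ring
  · calc (1 + a * c * b) * (1 - a * b) = 1 - a * b + a * (c * (1 - b * a)) * b := by noncomm_ring
      _ = 1 := by rw [h2]; noncomm_ring

/-- Perturbation by an operator that is bounded for the graph norm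
(Desch and Schappacher). -/
theorem IsC0Semigroup.exists_perturb_graphBounded (hT : IsC0Semigroup T) (G : E →ₗ.[ℂ] E)
    (hG : ∀ x y, (x, y) ∈ G.graph ↔ Gen T x y) (K : G.domain →ₗ[ℂ] G.domain) (c : ℝ)
    (hK : ∀ x, ‖(K x : E)‖ + ‖G (K x)‖ ≤ c * (‖(x : E)‖ + ‖G x‖)) :
    ∃ S : ℝ → E →L[ℂ] E, IsC0Semigroup S ∧
      ∀ x y, Gen S x y ↔ ∃ hx : x ∈ G.domain, G ⟨x, hx⟩ + K ⟨x, hx⟩ = y := by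
  have hG' : ∀ x y, Gen T x y ↔ ∃ hx : x ∈ G.domain, G ⟨x, hx⟩ = y := fun x y => by
    rw [← hG, LinearPMap.mem_graph_iff]
    exact ⟨fun ⟨z, h1, h2⟩ => by subst h1; exact ⟨z.2, h2⟩, fun ⟨hx, h⟩ => ⟨⟨x, hx⟩, rfl, h⟩⟩
  obtain ⟨l₀, d, hres⟩ := hT.exists_resolvent
  -- `(l - G) K (l - G)⁻¹` is bounded
  have hP : ∀ (l : ℝ) (R : E →L[ℂ] E), (∀ x y, Gen T x y ↔ x = R (l • x - y)) →
      ∃ (hm : ∀ z, R z ∈ G.domain) (P : E →L[ℂ] E), (∀ z, G ⟨R z, hm z⟩ = l • R z - z) ∧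
        (∀ z, P z = l • (K ⟨R z, hm z⟩ : E) - G (K ⟨R z, hm z⟩)) ∧
        (∀ z, R (P z) = K ⟨R z, hm z⟩) ∧ ∀ x : G.domain, R (l • (x : E) - G x) = x := by
    intro l R hR
    have h1 : ∀ z, Gen T (R z) (l • R z - z) := fun z => by rw [hR, sub_sub_cancel]
    have hm : ∀ z, R z ∈ G.domain := fun z => ((hG' _ _).1 (h1 z)).1
    have h2 : ∀ z, G ⟨R z, hm z⟩ = l • R z - z := fun z => ((hG' _ _).1 (h1 z)).2
    have h3 : ∀ x : G.domain, R (l • (x : E) - G x) = x := fun x =>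
      ((hR _ _).1 ((hG' _ _).2 ⟨x.2, rfl⟩)).symm
    let Rd : E →ₗ[ℂ] G.domain := LinearMap.codRestrict G.domain (R : E →ₗ[ℂ] E) hm
    let P₀ : E →ₗ[ℂ] E :=
      (l : ℂ) • (G.domain.subtype ∘ₗ K ∘ₗ Rd) - G.toFun ∘ₗ K ∘ₗ Rd
    have hP₀ : ∀ z, P₀ z = l • (K ⟨R z, hm z⟩ : E) - G (K ⟨R z, hm z⟩) := fun z => by
      rw [← Complex.coe_smul]
      rfl
    have hbd : ∀ z, ‖P₀ z‖ ≤ (|l| + 1) * (|c| * (‖R‖ + (|l| * ‖R‖ + 1))) * ‖z‖ := by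
      intro z
      rw [hP₀]
      have e1 := hK ⟨R z, hm z⟩
      rw [h2] at e1
      have e2 : ‖R z‖ ≤ ‖R‖ * ‖z‖ := R.le_opNorm z
      have e3 : ‖l • R z - z‖ ≤ |l| * (‖R‖ * ‖z‖) + ‖z‖ := by
        refine (norm_sub_le _ _).trans ?_
        rw [norm_smul, Real.norm_eq_abs]
        gcongr
      have e4 : c * (‖R z‖ + ‖l • R z - z‖) ≤ |c| * (‖R‖ * ‖z‖ + (|l| * (‖R‖ * ‖z‖) + ‖z‖)) :=
        mul_le_mul (le_abs_self c) (add_le_add e2 e3) (by positivity) (abs_nonneg c)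
      have e5 : ‖l • (K ⟨R z, hm z⟩ : E) - G (K ⟨R z, hm z⟩)‖ ≤
          |l| * ‖(K ⟨R z, hm z⟩ : E)‖ + ‖G (K ⟨R z, hm z⟩)‖ := by
        refine (norm_sub_le _ _).trans ?_
        rw [norm_smul, Real.norm_eq_abs]
      have p1 := norm_nonneg (K ⟨R z, hm z⟩ : E)
      have p2 := norm_nonneg (G (K ⟨R z, hm z⟩))
      have p3 := abs_nonneg l
      calc _ ≤ (|l| + 1) * (‖(K ⟨R z, hm z⟩ : E)‖ + ‖G (K ⟨R z, hm z⟩)‖) := by nlinarith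
        _ ≤ (|l| + 1) * (|c| * (‖R‖ * ‖z‖ + (|l| * (‖R‖ * ‖z‖) + ‖z‖))) := by
            gcongr
            exact e1.trans e4
        _ = _ := by ring
    refine ⟨hm, P₀.mkContinuous _ hbd, h2, hP₀, fun z => ?_, h3⟩
    rw [LinearMap.mkContinuous_apply, hP₀]
    exact h3 _
  set l₁ := max l₀ 1 with hl₁
  have hl₁0 : 0 < l₁ := lt_of_lt_of_le one_pos (le_max_right _ _)
  obtain ⟨R₁, -, hR₁⟩ := hres l₁ (le_max_left _ _) hl₁0
  obtain ⟨hm₁, P₁, hG₁, -, hRP₁, -⟩ := hP l₁ R₁ hR₁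
  -- Since `‖R‖ ≤ |d| / l`, the second entry forces `‖P₁ * R‖ < 1`.
  set l := max l₁ (‖P₁‖ * |d| + 1) with hl
  have hl0 : 0 < l := lt_of_lt_of_le hl₁0 (le_max_left _ _)
  obtain ⟨R, hRn, hR⟩ := hres l ((le_max_left _ _).trans (le_max_left _ _)) hl0
  obtain ⟨hm, P, hGR, hP, hRP, hRG⟩ := hP l R hR
  have hsmall : ‖P₁ * R‖ < 1 := by
    refine (norm_mul_le _ _).trans_lt ?_
    calc ‖P₁‖ * ‖R‖ ≤ ‖P₁‖ * (|d| / l) := by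
          gcongr
          exact hRn.trans (by gcongr; exact le_abs_self d)
      _ = (‖P₁‖ * |d|) / l := by ring
      _ < 1 := by
          rw [div_lt_one hl0]
          linarith [le_max_right l₁ (‖P₁‖ * |d| + 1)]
  -- Here `1 + (l₁ - l) R = (l₁ - G) R`, so `R₁ b = K R` while `b R₁ = P₁ R`. The norm of `K R` on
  -- `E` need not be small, but that of `P₁ R` is; swapping the factors makes `1 - K R` invertible.
  set b : E →L[ℂ] E := P₁ * (1 + ((l₁ - l : ℝ) : ℂ) • R) with hb
  have hb1 : ∀ z, (1 + ((l₁ - l : ℝ) : ℂ) • R) z = z + (l₁ - l) • R z := fun z => by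
    change z + ((l₁ - l : ℝ) : ℂ) • R z = _
    rw [Complex.coe_smul]
  have hba : b * R₁ = P₁ * R := by
    ext z
    have h1 := hRG ⟨R₁ z, hm₁ z⟩
    rw [hG₁] at h1
    have h2 : l • R₁ z - (l₁ • R₁ z - z) = z - (l₁ - l) • R₁ z := by
      rw [sub_smul]
      abel
    have h3 : R ((l₁ - l) • R₁ z) = (l₁ - l) • R (R₁ z) :=
      (R.restrictScalars ℝ).map_smul _ _
    simp only [] at h1
    rw [h2, map_sub, h3, sub_eq_iff_eq_add] at h1
    change P₁ ((1 + ((l₁ - l : ℝ) : ℂ) • R) (R₁ z)) = P₁ (R z)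
    rw [hb1, h1]
  have hab : ∀ z, (R₁ * b) z = K ⟨R z, hm z⟩ := fun z => by
    have h1 : (1 + ((l₁ - l : ℝ) : ℂ) • R) z = l₁ • R z - G ⟨R z, hm z⟩ := by
      rw [hb1, hGR, sub_smul]
      abel
    have h2 : R₁ ((1 + ((l₁ - l : ℝ) : ℂ) • R) z) = R z := by
      rw [h1]
      exact ((hR₁ _ _).1 ((hG' _ _).2 ⟨hm z, rfl⟩)).symm
    have h3 : R₁ (P₁ ((1 + ((l₁ - l : ℝ) : ℂ) • R) z)) = _ := hRP₁ _
    change R₁ (P₁ ((1 + ((l₁ - l : ℝ) : ℂ) • R) z)) = _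
    rw [h3]
    congr 3
  obtain ⟨w, hw⟩ := isUnit_one_sub_mul_swap (a := R₁) (b := b)
    (by rw [hba]; exact isUnit_one_sub_of_norm_lt_one hsmall)
  set W : E ≃L[ℂ] E := ContinuousLinearEquiv.unitsEquiv ℂ E w with hW
  have hWz : ∀ z, W z = z - K ⟨R z, hm z⟩ := fun z => by
    rw [hW, ContinuousLinearEquiv.unitsEquiv_apply, hw, ← hab]
    rfl
  -- On `D(G)`, `l - G - P = (l - G) W` and `l - G - K = W (l - G)`. Hence `W (l - G - P) = (l - G -
  -- K) W`, so `W` conjugates `G + P` to `G + K`.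
  obtain ⟨S, hS, hSP⟩ := hT.exists_perturb P
  refine ⟨_, hS.conj W, fun x y => ?_⟩
  rw [gen_conj_iff, hSP, hG']
  obtain ⟨z, rfl⟩ := W.surjective x
  rw [W.symm_apply_apply]
  -- `W z` and `z` differ by an element of `D(G)`.
  have hdom : W z ∈ G.domain ↔ z ∈ G.domain := by
    rw [hWz]
    exact ⟨fun h => by simpa using G.domain.add_mem h (K ⟨R z, hm z⟩).2,
      fun h => G.domain.sub_mem h (K ⟨R z, hm z⟩).2⟩
  have key : ∀ (hz : z ∈ G.domain) (hx : W z ∈ G.domain),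
      W (G ⟨z, hz⟩ + P z) = G ⟨W z, hx⟩ + K ⟨W z, hx⟩ := by
    intro hz hx
    have h1 : G ⟨W z, hx⟩ = G ⟨z, hz⟩ - G (K ⟨R z, hm z⟩) := by
      rw [← LinearPMap.map_sub]
      congr 1
      exact Subtype.ext (hWz z)
    have h2 : G ⟨z, hz⟩ + P z = l • z - (l • W z - G ⟨W z, hx⟩) := by
      rw [hP, h1, hWz, smul_sub]
      abel
    have h3 : (⟨R (l • W z - G ⟨W z, hx⟩), hm _⟩ : G.domain) = ⟨W z, hx⟩ :=
      Subtype.ext (hRG ⟨W z, hx⟩)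
    have h4 : W (l • z) = l • W z :=
      ((W : E →L[ℂ] E).restrictScalars ℝ).map_smul _ _
    rw [h2, _root_.map_sub, h4, hWz (l • W z - G ⟨W z, hx⟩), h3]
    abel
  constructor
  · rintro ⟨hz, h⟩
    refine ⟨hdom.2 hz, ?_⟩
    rw [← key hz (hdom.2 hz), h, sub_add_cancel, W.apply_symm_apply]
  · rintro ⟨hx, h⟩
    refine ⟨hdom.1 hx, ?_⟩
    rw [← h, ← key (hdom.1 hx) hx, W.symm_apply_apply, add_sub_cancel_right]

end Perturbation

/-! ### C₀-groups and mild solutions. -/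

section Group

variable {E F : Type*} [NormedAddCommGroup E] [NormedSpace ℂ E]
  [NormedAddCommGroup F] [NormedSpace ℂ F] {T S : ℝ → E →L[ℂ] E}

/-- A strongly continuous group of bounded operators. -/
structure IsC0Group (U : ℝ → E →L[ℂ] E) : Prop where
  map_zero : U 0 = 1
  map_add : ∀ s t : ℝ, U (s + t) = U s * U t
  continuous : ∀ x : E, Continuous fun t : ℝ => U t x

theorem gen_congr (h : ∀ t, 0 ≤ t → S t = T t) {x y : E} : Gen S x y ↔ Gen T x y := by
  refine tendsto_congr' ?_
  filter_upwards [self_mem_nhdsWithin] with t ht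
  rw [h t (le_of_lt ht)]

/-- For `x` in the domain of the generator of `S`, the derivative of `T(r) S(r) x` vanishes by the
product rule; density of that domain gives the rest. -/
theorem IsC0Semigroup.apply_apply_inverse [CompleteSpace E] (hT : IsC0Semigroup T)
    (hS : IsC0Semigroup S) (h : ∀ x y, Gen S x y → Gen T x (-y)) {t : ℝ} (ht : 0 ≤ t) (x : E) :
    T t (S t x) = x := by
  have key : ∀ x ∈ {x : E | ∃ y, Gen S x y}, T t (S t x) = x := by
    rintro x ⟨y, hxy⟩
    have hd : ∀ r ∈ Ioo 0 t, HasDerivWithinAt (fun r => T (max r 0) (S (max r 0) x)) 0 (Ioi r) r := by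
      intro r hr
      have h1 := hS.hasDerivAt hxy hr.1
      have h2 := hT.hasDerivAt (h _ _ (hS.gen_apply hxy hr.1.le)) hr.1
      rw [← max_eq_left hr.1.le] at h2
      have h3 := hasDerivAt_apply hT.continuous_max h1 (by
        simpa only [max_eq_left hr.1.le] using h2)
      rw [max_eq_left hr.1.le, _root_.map_neg, add_neg_cancel] at h3
      exact h3.hasDerivWithinAt
    have hc : Continuous fun r => T (max r 0) (S (max r 0) x) :=
      (continuous_apply_prod hT.continuous_max).comp
        (continuous_id.prodMk (hS.continuous_max x))
    have := intervalIntegral.integral_eq_sub_of_hasDeriv_right_of_le ht hc.continuousOn hd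
      (by simp)
    simp only [intervalIntegral.integral_zero, max_eq_left ht, max_self, hT.zero_apply,
      hS.zero_apply] at this
    exact sub_eq_zero.1 this.symm
  exact congrFun (Continuous.ext_on hS.dense_domain ((T t).continuous.comp (S t).continuous)
    continuous_id key) x

theorem exists_group_of_semigroups [CompleteSpace E] (hT : IsC0Semigroup T)
    (hS : IsC0Semigroup S) (h : ∀ x y, Gen S x y ↔ Gen T x (-y)) :
    ∃ U : ℝ → E →L[ℂ] E, IsC0Group U ∧ (∀ t, 0 ≤ t → U t = T t) ∧ ∀ t, 0 ≤ t → U (-t) = S t := by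
  have hTS : ∀ t, 0 ≤ t → T t * S t = 1 := fun t ht => by
    ext x
    exact hT.apply_apply_inverse hS (fun x y => (h x y).1) ht x
  have hST : ∀ t, 0 ≤ t → S t * T t = 1 := fun t ht => by
    ext x
    exact hS.apply_apply_inverse hT (fun x y hxy => (h _ _).2 (by rwa [neg_neg])) ht x
  -- One of the two factors is always the identity.
  let U : ℝ → E →L[ℂ] E := fun t => T (max t 0) * S (max (-t) 0)
  have hUp : ∀ t, 0 ≤ t → U t = T t := fun t ht => by
    simp only [U, max_eq_left ht, max_eq_right (neg_nonpos.2 ht), hS.map_zero, mul_one]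
  have hUn : ∀ t, 0 ≤ t → U (-t) = S t := fun t ht => by
    simp only [U, neg_neg, max_eq_left ht, max_eq_right (neg_nonpos.2 ht), hT.map_zero, one_mul]
  have e1 : ∀ s t, 0 ≤ s → 0 ≤ t → T s * S t = U (s - t) ∧ S t * T s = U (s - t) := by
    intro s t hs ht
    rcases le_total t s with hst | hst
    · have h0 : 0 ≤ s - t := sub_nonneg.2 hst
      rw [hUp _ h0]
      have a1 : T s = T (s - t) * T t := by rw [← hT.map_add _ _ h0 ht, sub_add_cancel]
      have a2 : T s = T t * T (s - t) := by rw [← hT.map_add _ _ ht h0, add_sub_cancel]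
      constructor
      · rw [a1, mul_assoc, hTS t ht, mul_one]
      · rw [a2, ← mul_assoc, hST t ht, one_mul]
    · have h0 : 0 ≤ t - s := sub_nonneg.2 hst
      rw [← neg_sub, hUn _ h0]
      have a1 : S t = S (t - s) * S s := by rw [← hS.map_add _ _ h0 hs, sub_add_cancel]
      have a2 : S t = S s * S (t - s) := by rw [← hS.map_add _ _ hs h0, add_sub_cancel]
      constructor
      · rw [a2, ← mul_assoc, hTS s hs, one_mul]
      · rw [a1, mul_assoc, hST s hs, mul_one]
  refine ⟨U, ⟨?_, fun s t => ?_, fun x => ?_⟩, hUp, hUn⟩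
  · rw [hUp 0 le_rfl, hT.map_zero]
  · rcases le_total 0 s with hs | hs <;> rcases le_total 0 t with ht | ht
    · rw [hUp _ (add_nonneg hs ht), hUp s hs, hUp t ht, hT.map_add _ _ hs ht]
    · have := (e1 s (-t) hs (neg_nonneg.2 ht)).1
      rw [sub_neg_eq_add] at this
      rw [← this, hUp s hs, ← hUn _ (neg_nonneg.2 ht), neg_neg]
    · have := (e1 t (-s) ht (neg_nonneg.2 hs)).2
      rw [sub_neg_eq_add, add_comm] at this
      rw [← this, hUp t ht, ← hUn _ (neg_nonneg.2 hs), neg_neg]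
    · have := hS.map_add _ _ (neg_nonneg.2 hs) (neg_nonneg.2 ht)
      rwa [← hUn _ (neg_nonneg.2 hs), ← hUn _ (neg_nonneg.2 ht), neg_neg, neg_neg,
        ← neg_add, ← hUn _ (by linarith), neg_neg] at this
  · exact (continuous_apply_prod hT.continuous_max).comp
      (continuous_id.prodMk ((hS.continuous_max x).comp continuous_neg))

/-- Second-order Taylor expansion when the second derivative exists only at `0`: the mean value
inequality is applied to `g r - (r² / 2) y`, whose derivative is `o(r)`. -/
theorem tendsto_two_div_sq {g h : ℝ → E} {y : E} (hg : ∀ t, HasDerivAt g (h t) t)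
    (hh : HasDerivAt h y 0) (hg0 : g 0 = 0) (hh0 : h 0 = 0) :
    Tendsto (fun t : ℝ => (2 / t ^ 2) • g t) (𝓝[≠] 0) (𝓝 y) := by
  rw [Metric.tendsto_nhds]
  intro ε hε
  have h1 := (hasDerivAt_iff_isLittleO.1 hh).def (c := ε / 4) (by positivity)
  simp only [hh0, sub_zero] at h1
  obtain ⟨δ, hδ, h2⟩ := Metric.eventually_nhds_iff.1 h1
  have h3 : ∀ᶠ t : ℝ in 𝓝[≠] 0, dist t 0 < δ :=
    nhdsWithin_le_nhds (Metric.ball_mem_nhds 0 hδ)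
  filter_upwards [h3, self_mem_nhdsWithin] with t ht ht0
  have ht0 : t ≠ 0 := ht0
  set k : ℝ → E := fun r => g r - (r ^ 2 / 2) • y with hk
  have hkd : ∀ r, HasDerivAt k (h r - r • y) r := fun r => by
    have : HasDerivAt (fun r : ℝ => r ^ 2 / 2) r r := by
      have := ((hasDerivAt_id r).pow 2).div_const 2
      simpa using this
    exact (hg r).sub (this.smul_const y)
  have h4 : ‖k t - k 0‖ ≤ ε / 4 * |t| * ‖t - 0‖ := by
    refine Convex.norm_image_sub_le_of_norm_hasDerivWithin_le (s := Metric.closedBall 0 |t|)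
      (fun r _ => (hkd r).hasDerivWithinAt) (fun r hr => ?_) (convex_closedBall _ _) ?_ ?_
    · have hr' : |r| ≤ |t| := by simpa using hr
      refine (h2 (y := r) ?_).trans ?_
      · rw [Real.dist_eq, sub_zero] at ht ⊢
        exact hr'.trans_lt ht
      · rw [Real.norm_eq_abs]
        gcongr
    · simp
    · simp
  have hk0 : k 0 = 0 := by simp [hk, hg0]
  rw [hk0, sub_zero, sub_zero, Real.norm_eq_abs, mul_assoc, ← sq, sq_abs] at h4
  have h5 : (2 / t ^ 2) • g t - y = (2 / t ^ 2) • k t := by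
    rw [hk, smul_sub, smul_smul]
    congr 1
    rw [show 2 / t ^ 2 * (t ^ 2 / 2) = 1 by field_simp, one_smul]
  rw [dist_eq_norm, h5, norm_smul, Real.norm_of_nonneg (by positivity)]
  calc 2 / t ^ 2 * ‖k t‖ ≤ 2 / t ^ 2 * (ε / 4 * t ^ 2) := by gcongr
    _ = ε / 2 := by field_simp; norm_num
    _ < ε := half_lt_self hε

variable {U : ℝ → E →L[ℂ] E}

theorem IsC0Group.isC0Semigroup (hU : IsC0Group U) : IsC0Semigroup U :=
  ⟨hU.map_zero, fun s t _ _ => hU.map_add s t, fun x => (hU.continuous x).continuousOn⟩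

theorem IsC0Group.map_add_apply (hU : IsC0Group U) (s t : ℝ) (x : E) :
    U (s + t) x = U s (U t x) := by rw [hU.map_add]; rfl

theorem IsC0Group.zero_apply (hU : IsC0Group U) (x : E) : U 0 x = x := by
  rw [hU.map_zero]; rfl

theorem IsC0Group.gen_apply (hU : IsC0Group U) {x y : E} (h : Gen U x y) (t : ℝ) :
    Gen U (U t x) (U t y) := by
  refine (((U t).continuous.tendsto y).comp h).congr fun r => ?_
  have h4 : ∀ (c : ℝ) (z : E), U t (c • z) = c • U t z :=
    fun c z => ((U t).restrictScalars ℝ).map_smul _ _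
  rw [Function.comp_apply, h4, map_sub, ← hU.map_add_apply, ← hU.map_add_apply, add_comm]

variable [CompleteSpace E]

theorem IsC0Group.hasDerivAt (hU : IsC0Group U) {x y : E} (h : Gen U x y) (t : ℝ) :
    HasDerivAt (fun r => U r x) (U t y) t := by
  -- The semigroup result gives a two-sided derivative only at positive times; it is taken at time
  -- `1` and transported by `U (t - 1)`.
  have h1 : HasDerivAt (fun r => U r x) (U 1 y) (t - (t - 1)) := by
    rw [sub_sub_cancel]
    refine (hU.isC0Semigroup.hasDerivAt h one_pos).congr_of_eventuallyEq ?_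
    filter_upwards [lt_mem_nhds (one_pos : (0 : ℝ) < 1)] with r hr
    rw [max_eq_left hr.le]
  have h2 := ((U (t - 1)).restrictScalars ℝ).hasFDerivAt.comp_hasDerivAt t
    (h1.comp_sub_const t (t - 1))
  have h3 : U t y = U (t - 1) (U 1 y) := by rw [← hU.map_add_apply, sub_add_cancel]
  rw [h3]
  refine h2.congr_of_eventuallyEq (Eventually.of_forall fun r => ?_)
  change U r x = U (t - 1) (U (r - (t - 1)) x)
  rw [← hU.map_add_apply, add_sub_cancel]

theorem IsC0Group.hasDerivAt_integral (hU : IsC0Group U) (x : E) (t : ℝ) :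
    HasDerivAt (fun r => ∫ s in (0 : ℝ)..r, U s x) (U t x) t :=
  ((hU.continuous x).integral_hasStrictDerivAt 0 t).hasDerivAt

theorem IsC0Group.gen_integral (hU : IsC0Group U) (x : E) (t : ℝ) :
    Gen U (∫ s in (0 : ℝ)..t, U s x) (U t x - x) := by
  have hpos : ∀ t, 0 ≤ t → Gen U (∫ s in (0 : ℝ)..t, U s x) (U t x - x) := by
    intro t ht
    have := hU.isC0Semigroup.gen_integral x ht
    rwa [intervalIntegral.integral_congr (g := fun s => U s x)] at this
    intro s hs
    rw [uIcc_of_le ht] at hs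
    simp only [max_eq_left hs.1]
  rcases le_total 0 t with ht | ht
  · exact hpos t ht
  · have h1 := (hU.gen_apply (hpos (-t) (neg_nonneg.2 ht)) t).neg
    have h2 : -U t (∫ s in (0 : ℝ)..(-t), U s x) = ∫ s in (0 : ℝ)..t, U s x := by
      rw [← (U t).intervalIntegral_comp_comm ((hU.continuous x).intervalIntegrable _ _)]
      simp_rw [← hU.map_add_apply]
      rw [intervalIntegral.integral_comp_add_left (fun s => U s x), add_zero, add_neg_cancel,
        intervalIntegral.integral_symm, neg_neg]
    rwa [h2, _root_.map_sub, ← hU.map_add_apply, add_neg_cancel, hU.zero_apply, neg_sub] at h1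

/-- Mild solutions are orbits. -/
theorem IsC0Group.eq_of_mild (hU : IsC0Group U) {w : ℝ → E} (hw : Continuous w)
    (h : ∀ t, Gen U (∫ s in (0 : ℝ)..t, w s) (w t - w 0)) (t : ℝ) : w t = U t (w 0) := by
  -- The difference of the two primitives starts at `0`, and its derivative is the generator applied
  -- to it. So `U (-r) (z r)` is constant, which gives `z = 0`.
  set z : ℝ → E := fun t => (∫ s in (0 : ℝ)..t, w s) - ∫ s in (0 : ℝ)..t, U s (w 0) with hz
  have hzd : ∀ t, HasDerivAt z (w t - U t (w 0)) t := fun t =>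
    (hw.integral_hasStrictDerivAt 0 t).hasDerivAt.sub (hU.hasDerivAt_integral _ t)
  have hzg : ∀ t, Gen U (z t) (w t - U t (w 0)) := fun t => by
    have := (h t).sub (hU.gen_integral (w 0) t)
    rwa [sub_sub_sub_cancel_right] at this
  have hφ : ∀ s, HasDerivAt (fun r => U (-r) (z r)) 0 s := fun s => by
    have h1 : HasDerivAt (fun r => U (-r) (z s)) (-U (-s) (w s - U s (w 0))) s := by
      have := (hU.hasDerivAt (hzg s) (-s)).scomp s (hasDerivAt_neg s)
      rw [neg_one_smul] at this
      exact this
    have := hasDerivAt_apply (L := fun r => U (-r))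
      (fun x => (hU.continuous x).comp continuous_neg) (hzd s) h1
    rwa [add_neg_cancel] at this
  have hφ0 : ∀ s, U (-s) (z s) = 0 := fun s => by
    have := is_const_of_deriv_eq_zero (fun s => (hφ s).differentiableAt)
      (fun s => (hφ s).deriv) s 0
    rw [this]
    simp [hz]
  have hz0 : z = fun _ => 0 := funext fun s => by
    rw [← hU.zero_apply (z s), ← add_neg_cancel s, hU.map_add_apply, hφ0, _root_.map_zero]
  have h1 := hzd t
  rw [hz0] at h1
  exact sub_eq_zero.1 (h1.unique (hasDerivAt_const t (0 : E)))

end Group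

/-! ### From the reduction matrix to the cosine function and well-posedness. -/

section Wave

variable {V X : Type*} [NormedAddCommGroup V] [NormedSpace ℂ V] [NormedAddCommGroup X]
  [NormedSpace ℂ X] {ι : V →L[ℂ] X} {A : X →ₗ.[ℂ] X}

theorem mem_graph_reductionMatrix (hι : Function.Injective ι) {v w : V} {x y : X} :
    ((v, x), (w, y)) ∈ (reductionMatrix ι hι A).graph ↔ x = ι w ∧ (ι v, y) ∈ A.graph := by
  rw [LinearPMap.mem_graph_iff, LinearPMap.mem_graph_iff]
  have hsymm : ∀ (x : X) (hx : x ∈ LinearMap.range (ι : V →ₗ[ℂ] X)),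
      ι ((LinearEquiv.ofInjective (ι : V →ₗ[ℂ] X) hι).symm ⟨x, hx⟩) = x := fun x hx =>
    congrArg Subtype.val ((LinearEquiv.ofInjective (ι : V →ₗ[ℂ] X) hι).apply_symm_apply ⟨x, hx⟩)
  constructor
  · rintro ⟨⟨⟨v', x'⟩, hp1, hp2⟩, h1, h2⟩
    obtain ⟨rfl, rfl⟩ := Prod.mk.inj h1
    obtain ⟨h3, h4⟩ := Prod.mk.inj h2
    refine ⟨?_, ⟨_, hp1⟩, rfl, h4⟩
    rw [← h3]
    exact (hsymm _ _).symm
  · rintro ⟨rfl, ⟨x', hx'⟩, h1, h2⟩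
    simp only [] at h1
    subst h1
    refine ⟨⟨(v, ι w), hx', ⟨w, rfl⟩⟩, rfl, Prod.ext (hι ?_) h2⟩
    exact hsymm _ _

/-- The group on `V × X` generated by the reduction matrix of `A`. -/
structure IsWaveGroup (ι : V →L[ℂ] X) (A : X →ₗ.[ℂ] X) (U : ℝ → (V × X) →L[ℂ] (V × X)) :
    Prop extends IsC0Group U where
  gen_iff : ∀ v x w y, Gen U (v, x) (w, y) ↔ x = ι w ∧ (ι v, y) ∈ A.graph
  neg_apply : ∀ t v x, U (-t) (v, x) = ((U t (v, -x)).1, -(U t (v, -x)).2)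

theorem isClosed_of_resolvent {l : ℝ} {L : X →L[ℂ] V}
    (hL : ∀ x y, (x, y) ∈ A.graph ↔ x = ι (L (l • x - y))) : A.IsClosed := by
  have : (A.graph : Set (X × X)) = {p | p.1 = ι (L (l • p.1 - p.2))} := by
    ext ⟨x, y⟩
    exact hL x y
  rw [LinearPMap.IsClosed, this]
  exact isClosed_eq continuous_fst (by fun_prop)

theorem domainEmbeds_of_resolvent {l : ℝ} {L : X →L[ℂ] V}
    (hL : ∀ x y, (x, y) ∈ A.graph ↔ x = ι (L (l • x - y))) : DomainEmbeds ι A := by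
  refine ⟨(L : X →ₗ[ℂ] V) ∘ₗ ((l : ℂ) • A.domain.subtype - A.toFun), fun x => ?_,
    ‖L‖ * (|l| + 1), fun x => ?_⟩
  · have h1 := ((hL x (A x)).1 (A.mem_graph x)).symm
    rw [← Complex.coe_smul] at h1
    exact h1
  · change ‖L ((l : ℂ) • (x : X) - A x)‖ ≤ _
    have h1 : ‖(l : ℂ) • (x : X) - A x‖ ≤ |l| * ‖(x : X)‖ + ‖A x‖ := by
      refine (norm_sub_le _ _).trans ?_
      rw [norm_smul, Complex.norm_real, Real.norm_eq_abs]
    have p1 := norm_nonneg (x : X)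
    have p2 := norm_nonneg (A x)
    have p3 := abs_nonneg l
    calc _ ≤ ‖L‖ * (|l| * ‖(x : X)‖ + ‖A x‖) := (L.le_opNorm _).trans (by gcongr)
      _ ≤ ‖L‖ * ((|l| + 1) * (‖(x : X)‖ + ‖A x‖)) := by gcongr; nlinarith
      _ = _ := by ring

variable {U : ℝ → (V × X) →L[ℂ] (V × X)}

theorem IsWaveGroup.isCosineFunction (hU : IsWaveGroup ι A U) :
    IsCosineFunction fun t =>
      ContinuousLinearMap.snd ℂ V X ∘L U t ∘L ContinuousLinearMap.inr ℂ V X where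
  map_zero := by
    ext x
    change (U 0 (0, x)).2 = x
    rw [hU.zero_apply]
  dAlembert t s := by
    ext x
    change (U (t + s) (0, x)).2 + (U (t - s) (0, x)).2 = (2 : ℂ) • (U t (0, (U s (0, x)).2)).2
    -- The sine component is odd and the cosine component even, so `U s + U (-s)` maps `(0, x)` to
    -- `(0, 2 C(s) x)`.
    have h1 : U (-s) (0, x) = (-(U s (0, x)).1, (U s (0, x)).2) := by
      have : ((0 : V), -x) = -(0, x) := by simp
      rw [hU.neg_apply, this, _root_.map_neg]
      simp
    rw [sub_eq_add_neg, hU.map_add_apply, hU.map_add_apply, h1, ← Prod.snd_add,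
      ← _root_.map_add, ← Prod.smul_snd, ← _root_.map_smul]
    congr 2
    exact Prod.ext (by simp) (by simp [two_smul])
  continuous x := continuous_snd.comp (hU.continuous (0, x))

variable [CompleteSpace V] [CompleteSpace X]

/-- Time reversal: `J (v, x) = (v, -x)` conjugates the reduction matrix to its negative, which
therefore also generates a semigroup. -/
theorem exists_isWaveGroup (hι : Function.Injective ι)
    (h : GeneratesC0Semigroup (reductionMatrix ι hι A)) :
    ∃ U : ℝ → (V × X) →L[ℂ] (V × X), IsWaveGroup ι A U := by
  obtain ⟨T, hT, hG⟩ := h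
  have hG' : ∀ v x w y, Gen T (v, x) (w, y) ↔ x = ι w ∧ (ι v, y) ∈ A.graph := fun v x w y => by
    rw [← mem_graph_reductionMatrix hι]
    exact (hG _ _).symm
  let J : (V × X) ≃L[ℂ] (V × X) :=
    (ContinuousLinearEquiv.refl ℂ V).prodCongr (ContinuousLinearEquiv.neg ℂ)
  have hJ : ∀ p, J p = (p.1, -p.2) := fun p => rfl
  have hJ' : ∀ p, J.symm p = (p.1, -p.2) := fun p => rfl
  obtain ⟨U, hU, hUT, hUS⟩ := exists_group_of_semigroups hT (hT.conj J) (by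
    rintro ⟨v, x⟩ ⟨w, y⟩
    rw [gen_conj_iff, hJ', hJ', Prod.neg_mk, hG', hG', _root_.map_neg, neg_eq_iff_eq_neg])
  have hp : ∀ t, 0 ≤ t → ∀ v x, U (-t) (v, x) = ((U t (v, -x)).1, -(U t (v, -x)).2) := by
    intro t ht v x
    rw [hUS t ht, hUT t ht]
    rfl
  refine ⟨U, hU, fun v x w y => ?_, fun t v x => ?_⟩
  · rw [gen_congr hUT, hG']
  · rcases le_total 0 t with ht | ht
    · exact hp t ht v x
    · have h1 := hp (-t) (neg_nonneg.2 ht) v (-x)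
      rw [neg_neg, neg_neg] at h1
      rw [h1]
      simp

/-- Solving `(l - matrix) (v, x) = (0, z)` gives `x = l v` and `(l² - A) v = z`. The first component
of the resolvent of the matrix is thus the resolvent of `A` at `l²`, bounded from `X` to `V`. -/
theorem IsWaveGroup.exists_resolvent (hU : IsWaveGroup ι A U)
    (hdom : ∀ x ∈ A.domain, x ∈ range ι) :
    ∃ (l : ℝ) (L : X →L[ℂ] V), ∀ x y, (x, y) ∈ A.graph ↔ x = ι (L (l • x - y)) := by
  obtain ⟨l₀, c, h⟩ := hU.isC0Semigroup.exists_resolvent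
  obtain ⟨R, -, hR⟩ := h (max l₀ 1) (le_max_left _ _) (lt_of_lt_of_le one_pos (le_max_right _ _))
  set l := max l₀ 1
  refine ⟨l * l, ContinuousLinearMap.fst ℂ V X ∘L R ∘L ContinuousLinearMap.inr ℂ V X,
    fun x y => ?_⟩
  change _ ↔ x = ι (R (0, (l * l) • x - y)).1
  have hs : ∀ (c : ℝ) (z : V), ι (c • z) = c • ι z := fun c z =>
    (ι.restrictScalars ℝ).map_smul c z
  constructor
  · intro hxy
    obtain ⟨v, rfl⟩ := hdom x (LinearPMap.mem_domain_of_mem_graph hxy)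
    have h1 := (hR _ _).1 ((hU.gen_iff v (ι (l • v)) (l • v) y).2 ⟨rfl, hxy⟩)
    have h2 : l • (v, ι (l • v)) - (l • v, y) = (0, (l * l) • ι v - y) := by
      rw [hs, Prod.smul_mk, Prod.mk_sub_mk, sub_self, smul_smul]
    rw [h2] at h1
    rw [← h1]
  · intro hx
    set p := R (0, (l * l) • x - y) with hp
    have h1 : Gen U p (l • p - (0, (l * l) • x - y)) := by rw [hR, sub_sub_cancel]
    have h2 := (hU.gen_iff p.1 p.2 _ _).1 h1
    have h3 : p.2 = l • ι p.1 := by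
      rw [h2.1, ← hs]
      simp
    have h4 : (l • p).2 - ((0, (l * l) • x - y) : V × X).2 = y := by
      rw [Prod.smul_snd, h3, smul_smul, ← hx, sub_sub_cancel]
    have h5 := h2.2
    rwa [h4, ← hx] at h5

theorem IsWaveGroup.hasDerivAt_snd (hU : IsWaveGroup ι A U) {v w : V} {x y : X}
    (h : Gen U (v, x) (w, y)) (t : ℝ) :
    HasDerivAt (fun r => (U r (v, x)).2) (U t (w, y)).2 t :=
  (ContinuousLinearMap.snd ℝ V X).hasFDerivAt.comp_hasDerivAt t (hU.hasDerivAt h t)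

theorem IsWaveGroup.hasDerivAt_fst (hU : IsWaveGroup ι A U) {v w : V} {x y : X}
    (h : Gen U (v, x) (w, y)) (t : ℝ) :
    HasDerivAt (fun r => ι (U r (v, x)).1) (ι (U t (w, y)).1) t :=
  ((ι.restrictScalars ℝ) ∘L ContinuousLinearMap.fst ℝ V X).hasFDerivAt.comp_hasDerivAt t
    (hU.hasDerivAt h t)

theorem snd_integral {f : ℝ → V × X} (hf : Continuous f) (t : ℝ) :
    (∫ s in (0 : ℝ)..t, f s).2 = ∫ s in (0 : ℝ)..t, (f s).2 :=
  ((ContinuousLinearMap.snd ℝ V X).intervalIntegral_comp_comm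
    (hf.intervalIntegrable (μ := MeasureTheory.volume) 0 t)).symm

theorem fst_integral {f : ℝ → V × X} (hf : Continuous f) (t : ℝ) :
    (∫ s in (0 : ℝ)..t, f s).1 = ∫ s in (0 : ℝ)..t, (f s).1 :=
  ((ContinuousLinearMap.fst ℝ V X).intervalIntegral_comp_comm
    (hf.intervalIntegrable (μ := MeasureTheory.volume) 0 t)).symm

theorem IsWaveGroup.integral_mem_graph (hU : IsWaveGroup ι A U) (x : X) (t : ℝ) :
    ι (U t (0, x)).1 = (∫ s in (0 : ℝ)..t, U s (0, x)).2 ∧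
      (ι (∫ s in (0 : ℝ)..t, U s (0, x)).1, (U t (0, x)).2 - x) ∈ A.graph := by
  have h := (hU.gen_iff _ _ _ _).1 (hU.gen_integral (0, x) t)
  simp only [sub_zero] at h
  exact ⟨h.1.symm, h.2⟩

/-- `ι S(t) x` is a primitive of `C(t) x`, where `S` and `C` are the sine and cosine functions. -/
theorem IsWaveGroup.hasDerivAt_sine (hU : IsWaveGroup ι A U) (x : X) (t : ℝ) :
    HasDerivAt (fun r => ι (U r (0, x)).1) (U t (0, x)).2 t := by
  have h1 : (fun r => ι (U r (0, x)).1) = fun r => (∫ s in (0 : ℝ)..r, U s (0, x)).2 :=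
    funext fun r => (hU.integral_mem_graph x r).1
  rw [h1]
  exact (ContinuousLinearMap.snd ℝ V X).hasFDerivAt.comp_hasDerivAt t
    (hU.hasDerivAt_integral (0, x) t)

/-- If `ι v ∈ D(A)`, both sides are the derivative of the sine function at `ι v`; such `v` are dense
in `V`. This allows position to be bounded by the initial position in the norm of `X` alone. -/
theorem IsWaveGroup.fst_apply_eq (hU : IsWaveGroup ι A U) (v : V) (t : ℝ) : ι (U t (v, 0)).1 = (U t (0, ι v)).2 := by
  have hd : Dense {v : V | ι v ∈ A.domain} := by
    have h1 : {p : V × X | ∃ q, Gen U p q} ⊆ Prod.fst ⁻¹' {v : V | ι v ∈ A.domain} := by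
      rintro ⟨v, x⟩ ⟨⟨w, y⟩, h⟩
      exact LinearPMap.mem_domain_of_mem_graph ((hU.gen_iff _ _ _ _).1 h).2
    have h2 := hU.isC0Semigroup.dense_domain.mono h1
    intro v
    have h3 := h2 (v, (0 : X))
    exact map_mem_closure continuous_fst h3 fun p hp => hp
  have hc : ∀ v ∈ {v : V | ι v ∈ A.domain}, ι (U t (v, 0)).1 = (U t (0, ι v)).2 := by
    intro v hv
    have hg : Gen U (0, ι v) (v, 0) := by
      rw [hU.gen_iff, _root_.map_zero]
      exact ⟨rfl, A.graph.zero_mem⟩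
    exact (hU.hasDerivAt_fst hg t).unique (hU.hasDerivAt_sine (ι v) t)
  refine congrFun (Continuous.ext_on hd (f := fun v => ι (U t (v, 0)).1)
    (g := fun v => (U t (0, ι v)).2) ?_ ?_ hc) v
  · fun_prop
  · fun_prop

/-- On `D(A)` the limit is a Taylor expansion of the cosine orbit. Conversely, `A` maps `∫₀ᵗ S(s)x
ds` to `C(t)x - x`, with `S` the sine function; multiplied by `2 / t²` the integral tends to `x`,
and closedness of `A` identifies the limit. -/
theorem IsWaveGroup.generatesCOF (hU : IsWaveGroup ι A U) (hdom : ∀ x ∈ A.domain, x ∈ range ι) :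
    GeneratesCOF A := by
  obtain ⟨l, L, hL⟩ := hU.exists_resolvent hdom
  have hcl : IsClosed (A.graph : Set (X × X)) := isClosed_of_resolvent hL
  refine ⟨_, hU.isCosineFunction, fun x y => ?_⟩
  change _ ↔ Tendsto (fun t : ℝ => (2 / t ^ 2) • ((U t (0, x)).2 - x)) (𝓝[≠] 0) (𝓝 y)
  constructor
  · intro hxy
    obtain ⟨v, rfl⟩ := hdom x (LinearPMap.mem_domain_of_mem_graph hxy)
    have h1 : Gen U (0, ι v) (v, 0) := by
      rw [hU.gen_iff, _root_.map_zero]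
      exact ⟨rfl, A.graph.zero_mem⟩
    have h2 : Gen U (v, 0) (0, y) := by
      rw [hU.gen_iff, _root_.map_zero]
      exact ⟨rfl, hxy⟩
    have h3 := hU.hasDerivAt_snd h2 0
    rw [hU.zero_apply] at h3
    refine tendsto_two_div_sq (h := fun t => (U t (v, 0)).2)
      (fun t => (hU.hasDerivAt_snd h1 t).sub_const (ι v)) h3 ?_ ?_
    · rw [hU.zero_apply, sub_self]
    · simp only [hU.zero_apply]
  · intro h
    have hg : Tendsto (fun t : ℝ => (2 / t ^ 2) • ι (∫ s in (0 : ℝ)..t, U s (0, x)).1)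
        (𝓝[≠] 0) (𝓝 x) := by
      have h3 := hU.hasDerivAt_sine x 0
      rw [hU.zero_apply] at h3
      refine tendsto_two_div_sq (h := fun t => ι (U t (0, x)).1) (fun t => ?_) h3 ?_ ?_
      · exact ((ι.restrictScalars ℝ) ∘L ContinuousLinearMap.fst ℝ V X).hasFDerivAt.comp_hasDerivAt
          t (hU.hasDerivAt_integral (0, x) t)
      · simp
      · simp only [hU.zero_apply, _root_.map_zero]
    refine hcl.mem_of_tendsto (hg.prodMk_nhds h) (Eventually.of_forall fun t => ?_)
    have := A.graph.smul_mem (((2 / t ^ 2 : ℝ)) : ℂ) (hU.integral_mem_graph x t).2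
    rw [Complex.coe_smul] at this
    exact this

theorem generatesCOFWithPhaseSpace_of_reduction (hι : Function.Injective ι)
    (hdom : ∀ x ∈ A.domain, x ∈ range ι) (h : GeneratesC0Semigroup (reductionMatrix ι hι A)) :
    GeneratesCOFWithPhaseSpace ι A := by
  obtain ⟨U, hU⟩ := exists_isWaveGroup hι h
  obtain ⟨l, L, hL⟩ := hU.exists_resolvent hdom
  exact ⟨isClosed_of_resolvent hL, hU.generatesCOF hdom, hι, domainEmbeds_of_resolvent hL, h⟩

/-- A classical solution, together with its velocity, is an orbit of the group on `V × X`. -/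
theorem IsWaveGroup.classicalSolution_eq (hU : IsWaveGroup ι A U) (hι : Function.Injective ι)
    (hdom : ∀ x ∈ A.domain, x ∈ range ι) {u : ℝ → X} (hu : IsClassicalSolution A u) {v₀ : V}
    (hv₀ : ι v₀ = u 0) (t : ℝ) :
    u t = ι (U t (v₀, deriv u 0)).1 ∧ deriv u t = (U t (v₀, deriv u 0)).2 := by
  obtain ⟨l, L, hL⟩ := hU.exists_resolvent hdom
  have hc2 := hu.contDiff
  have hd1 : ContDiff ℝ 1 (deriv u) := by
    have : ContDiff ℝ (1 + 1) u := by
      rw [one_add_one_eq_two]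
      exact hc2
    exact (contDiff_succ_iff_deriv.1 this).2.2
  have hcu : Continuous u := hc2.continuous
  have hcd : Continuous (deriv u) := hd1.continuous
  have hcdd : Continuous (deriv (deriv u)) := hd1.continuous_deriv le_rfl
  -- The resolvent lifts `u` to a function continuous in the norm of `V`.
  set v : ℝ → V := fun t => L (l • u t - deriv (deriv u) t) with hv
  have hιv : ∀ t, ι (v t) = u t := fun t => ((hL _ _).1 (hu.equation t)).symm
  have hv0 : v 0 = v₀ := hι (by rw [hιv, hv₀])
  have hcv : Continuous v := by fun_prop
  set w : ℝ → V × X := fun t => (v t, deriv u t) with hw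
  have hcw : Continuous w := hcv.prodMk hcd
  have key : ∀ t, Gen U (∫ s in (0 : ℝ)..t, w s) (w t - w 0) := by
    intro t
    have h2 : ∫ s in (0 : ℝ)..t, deriv u s = u t - u 0 :=
      intervalIntegral.integral_deriv_eq_sub
        (fun s _ => (hc2.differentiable (by norm_num)).differentiableAt)
        (hcd.intervalIntegrable _ _)
    have h3 : ∫ s in (0 : ℝ)..t, deriv (deriv u) s = deriv u t - deriv u 0 :=
      intervalIntegral.integral_deriv_eq_sub
        (fun s _ => (hd1.differentiable (by norm_num)).differentiableAt)
        (hcdd.intervalIntegrable _ _)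
    have h4 : ι (∫ s in (0 : ℝ)..t, v s) = ∫ s in (0 : ℝ)..t, u s := by
      rw [← ι.intervalIntegral_comp_comm (hcv.intervalIntegrable _ _)]
      simp only [hιv]
    have h5 : ∫ s in (0 : ℝ)..t, v s =
        L (l • (∫ s in (0 : ℝ)..t, u s) - (deriv u t - deriv u 0)) := by
      have h7 : ∫ s in (0 : ℝ)..t, (l • u s - deriv (deriv u) s) =
          l • (∫ s in (0 : ℝ)..t, u s) - ∫ s in (0 : ℝ)..t, deriv (deriv u) s := by
        rw [← intervalIntegral.integral_smul]
        exact intervalIntegral.integral_sub ((hcu.const_smul l).intervalIntegrable _ _)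
          (hcdd.intervalIntegrable _ _)
      rw [hv, L.intervalIntegral_comp_comm ((by fun_prop :
        Continuous fun s => l • u s - deriv (deriv u) s).intervalIntegrable _ _), h7, h3]
    have h6 : ∫ s in (0 : ℝ)..t, w s = (∫ s in (0 : ℝ)..t, v s, u t - u 0) := by
      refine Prod.ext (fst_integral hcw t) ?_
      rw [snd_integral hcw]
      exact h2
    rw [h6, hw, Prod.mk_sub_mk, hU.gen_iff, _root_.map_sub, hιv, hιv]
    refine ⟨rfl, ?_⟩
    rw [hL, h4, ← h5, h4]
  have := hU.eq_of_mild hcw key t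
  rw [hw] at this
  simp only [hv0] at this
  rw [← this]
  exact ⟨(hιv t).symm, rfl⟩

theorem IsWaveGroup.isClassicalSolution (hU : IsWaveGroup ι A U) {v w : V}
    (hv : ι v ∈ A.domain) :
    IsClassicalSolution A (fun t => ι (U t (v, ι w)).1) ∧
      deriv (fun t => ι (U t (v, ι w)).1) = fun t => (U t (v, ι w)).2 := by
  have hg : Gen U (v, ι w) (w, A ⟨ι v, hv⟩) := by
    rw [hU.gen_iff]
    exact ⟨rfl, A.mem_graph ⟨ι v, hv⟩⟩
  have hgt : ∀ t, (U t (v, ι w)).2 = ι (U t (w, A ⟨ι v, hv⟩)).1 ∧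
      (ι (U t (v, ι w)).1, (U t (w, A ⟨ι v, hv⟩)).2) ∈ A.graph := fun t =>
    (hU.gen_iff _ _ _ _).1 (hU.gen_apply hg t)
  have h1 : ∀ t, HasDerivAt (fun t => ι (U t (v, ι w)).1) (U t (v, ι w)).2 t := fun t => by
    rw [(hgt t).1]
    exact hU.hasDerivAt_fst hg t
  have h2 := hU.hasDerivAt_snd hg
  have e1 : deriv (fun t => ι (U t (v, ι w)).1) = fun t => (U t (v, ι w)).2 :=
    funext fun t => (h1 t).deriv
  have e2 : deriv (fun t => (U t (v, ι w)).2) = fun t => (U t (w, A ⟨ι v, hv⟩)).2 :=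
    funext fun t => (h2 t).deriv
  refine ⟨⟨?_, fun t => ?_⟩, e1⟩
  · rw [← one_add_one_eq_two, contDiff_succ_iff_deriv]
    refine ⟨fun t => (h1 t).differentiableAt, by simp, ?_⟩
    rw [e1, contDiff_one_iff_deriv, e2]
    exact ⟨fun t => (h2 t).differentiableAt, continuous_snd.comp (hU.continuous _)⟩
  · rw [e1, e2]
    exact (hgt t).2

theorem wellPosed_of_reduction (hι : Function.Injective ι)
    (hdom : ∀ x ∈ A.domain, x ∈ range ι) (h : GeneratesC0Semigroup (reductionMatrix ι hι A)) :
    WellPosed ι A := by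
  obtain ⟨U, hU⟩ := exists_isWaveGroup hι h
  have hbd : ∀ τ : ℝ, ∃ M : ℝ, 0 ≤ M ∧ ∀ t, |t| ≤ τ → ∀ p, ‖U t p‖ ≤ M * ‖p‖ := fun τ => by
    obtain ⟨M, hM⟩ := exists_norm_le_of_continuous hU.continuous (-τ) τ
    refine ⟨max M 0, le_max_right _ _, fun t ht p => ((U t).le_opNorm p).trans ?_⟩
    have := (hM t (abs_le.1 ht)).trans (le_max_left M 0)
    gcongr
  refine ⟨?_, ?_, hdom, fun τ => ?_, fun τ => ?_⟩
  · intro f hf g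
    obtain ⟨v, rfl⟩ := hdom f hf
    obtain ⟨h1, h2⟩ := hU.isClassicalSolution (w := g) hf
    refine ⟨_, ⟨h1, ?_, ?_⟩, ?_⟩
    · simp only [hU.zero_apply]
    · rw [h2]
      simp only [hU.zero_apply]
    · rintro u ⟨hu, hu0, hu1⟩
      funext t
      rw [(hU.classicalSolution_eq hι hdom hu hu0.symm t).1, hu1]
  · refine hU.isC0Semigroup.dense_domain.mono ?_
    rintro ⟨v, x⟩ ⟨⟨w, y⟩, hp⟩
    obtain ⟨h1, h2⟩ := (hU.gen_iff _ _ _ _).1 hp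
    exact ⟨LinearPMap.mem_domain_of_mem_graph h2, w, h1.symm⟩
  · obtain ⟨M, hM0, hM⟩ := hbd τ
    -- The max norm on `V × X` bounds each component by `M` times the data.
    refine ⟨2 * M, fun u hu t ht v₀ v hv₀ hv => ?_⟩
    obtain ⟨h1, h2⟩ := hU.classicalSolution_eq hι hdom hu hv₀ t
    have h3 : v = (U t (v₀, deriv u 0)).1 := hι (by rw [hv, h1])
    have h4 := hM t ht (v₀, deriv u 0)
    have h5 : ‖((v₀, deriv u 0) : V × X)‖ ≤ ‖v₀‖ + ‖deriv u 0‖ := by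
      rw [Prod.norm_def]
      exact max_le_add_of_nonneg (norm_nonneg _) (norm_nonneg _)
    have h6 := h4.trans (mul_le_mul_of_nonneg_left h5 hM0)
    rw [h3, h2]
    have h7 := (norm_fst_le (U t (v₀, deriv u 0))).trans h6
    have h8 := (norm_snd_le (U t (v₀, deriv u 0))).trans h6
    linarith
  · obtain ⟨M, hM0, hM⟩ := hbd τ
    -- The initial position evolves by the cosine function, bounded by `M` on `X`; the initial
    -- velocity by the sine function, bounded by `M` into `V` and then by `‖ι‖`.
    refine ⟨M + ‖ι‖ * M, fun u hu t ht => ?_⟩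
    obtain ⟨v₀, hv₀⟩ := hdom _ (LinearPMap.mem_domain_of_mem_graph (hu.equation 0))
    have h1 := (hU.classicalSolution_eq hι hdom hu hv₀ t).1
    have h2 : ((v₀, deriv u 0) : V × X) = (v₀, 0) + (0, deriv u 0) := by simp
    rw [h2, _root_.map_add, Prod.fst_add, _root_.map_add, hU.fst_apply_eq, hv₀] at h1
    have hz : ∀ x : X, ‖((0 : V), x)‖ = ‖x‖ := fun x => by simp [Prod.norm_def]
    have h3 : ‖(U t (0, u 0)).2‖ ≤ M * ‖u 0‖ := by
      have := (norm_snd_le _).trans (hM t ht (0, u 0))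
      rwa [hz] at this
    have h4 : ‖ι (U t (0, deriv u 0)).1‖ ≤ ‖ι‖ * (M * ‖deriv u 0‖) := by
      have := (norm_fst_le _).trans (hM t ht (0, deriv u 0))
      rw [hz] at this
      exact (ι.le_opNorm _).trans (by gcongr)
    rw [h1]
    refine (norm_add_le _ _).trans ((add_le_add h3 h4).trans ?_)
    have p1 := norm_nonneg (u 0)
    have p2 := norm_nonneg (deriv u 0)
    have p3 : 0 ≤ ‖ι‖ * M := by positivity
    nlinarith [mul_nonneg hM0 p2, mul_nonneg p3 p1]

end Wave

/-! ### Perturbing the reduction matrix. -/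

section PerturbReduction

variable {V X : Type*} [NormedAddCommGroup V] [NormedSpace ℂ V] [NormedAddCommGroup X]
  [NormedSpace ℂ X] {ι : V →L[ℂ] X} {A : X →ₗ.[ℂ] X}

theorem reductionMatrix_apply_eq (hι : Function.Injective ι) {v w : V} {x y : X}
    (h : x = ι w ∧ (ι v, y) ∈ A.graph) (hd : (v, x) ∈ (reductionMatrix ι hι A).domain) :
    reductionMatrix ι hι A ⟨(v, x), hd⟩ = (w, y) := by
  obtain ⟨p, hp, hpq⟩ := LinearPMap.mem_graph_iff _ |>.1
    ((mem_graph_reductionMatrix hι (A := A)).2 h)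
  refine Eq.trans ?_ hpq
  congr 1
  exact Subtype.ext hp.symm

/-- The reduction matrix of `A + ι T₁ + T₂`, with `T₁` bounded from `[D(A)]` to `V` and `T₂`
bounded from `V` to `X`, generates a C₀-semigroup if that of `A` does. -/
theorem generatesC0Semigroup_reductionMatrix_perturb [CompleteSpace V] [CompleteSpace X]
    {A' : X →ₗ.[ℂ] X} (hι : Function.Injective ι)
    (h : GeneratesC0Semigroup (reductionMatrix ι hι A)) (T₁ : A.domain →ₗ[ℂ] V)
    (hT₁ : GraphBounded A T₁) (T₂ : V →L[ℂ] X)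
    (hA' : ∀ v y, (ι v, y) ∈ A'.graph ↔
      ∃ hx : ι v ∈ A.domain, A ⟨ι v, hx⟩ + ι (T₁ ⟨ι v, hx⟩) + T₂ v = y) :
    GeneratesC0Semigroup (reductionMatrix ι hι A') := by
  obtain ⟨T, hT, hG⟩ := h
  obtain ⟨c, hc⟩ := hT₁
  set G := reductionMatrix ι hι A with hGdef
  -- The values lie in `0 × V`, and `G` sends `(0, ι w)` to `(w, 0)`. So boundedness of `T₁` into
  -- `V` is exactly what controls `K` in the graph norm of `G`.
  let K : G.domain →ₗ[ℂ] G.domain :=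
    { toFun := fun p => ⟨(0, ι (T₁ ⟨ι p.1.1, p.2.1⟩)),
        ⟨(A.domain.comap (ι : V →ₗ[ℂ] X)).zero_mem, ⟨_, rfl⟩⟩⟩
      map_add' := fun p q => by
        have : (⟨ι (p + q).1.1, (p + q).2.1⟩ : A.domain) =
            ⟨ι p.1.1, p.2.1⟩ + ⟨ι q.1.1, q.2.1⟩ := Subtype.ext (map_add ι _ _)
        refine Subtype.ext (Prod.ext (by simp) ?_)
        change ι (T₁ _) = ι (T₁ _) + ι (T₁ _)
        rw [this, map_add, map_add]
      map_smul' := fun a p => by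
        have : (⟨ι (a • p).1.1, (a • p).2.1⟩ : A.domain) = a • ⟨ι p.1.1, p.2.1⟩ :=
          Subtype.ext (map_smul ι _ _)
        refine Subtype.ext (Prod.ext (by simp) ?_)
        change ι (T₁ _) = a • ι (T₁ _)
        rw [this, map_smul, map_smul] }
  have hK : ∀ p : G.domain, (K p : V × X) = (0, ι (T₁ ⟨ι p.1.1, p.2.1⟩)) := fun p => rfl
  have hGK : ∀ p : G.domain, G (K p) = (T₁ ⟨ι p.1.1, p.2.1⟩, 0) := fun p =>
    reductionMatrix_apply_eq hι ⟨rfl, by rw [map_zero]; exact A.graph.zero_mem⟩ _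
  obtain ⟨S, hS, hSG⟩ := hT.exists_perturb_graphBounded G hG K
    ((‖ι‖ + 1) * (|c| * (‖ι‖ + 1))) (fun p => by
      rw [hK, hGK]
      set t := T₁ ⟨ι p.1.1, p.2.1⟩ with ht
      have e1 : ‖((0, ι t) : V × X)‖ ≤ ‖ι‖ * ‖t‖ := by
        rw [Prod.norm_def]
        simpa using ι.le_opNorm t
      have e2 : ‖((t, 0) : V × X)‖ = ‖t‖ := by simp [Prod.norm_def]
      have e3 : ‖t‖ ≤ c * (‖ι p.1.1‖ + ‖A ⟨ι p.1.1, p.2.1⟩‖) := hc _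
      have e4 : ‖ι p.1.1‖ ≤ ‖ι‖ * ‖(p : V × X)‖ :=
        (ι.le_opNorm _).trans (by gcongr; exact norm_fst_le _)
      have e5 : ‖A ⟨ι p.1.1, p.2.1⟩‖ ≤ ‖G p‖ := norm_snd_le (G p)
      have p1 := norm_nonneg (p : V × X)
      have p2 := norm_nonneg (G p)
      have p3 := norm_nonneg ι
      have e6 : ‖t‖ ≤ |c| * ((‖ι‖ + 1) * (‖(p : V × X)‖ + ‖G p‖)) :=
        e3.trans (mul_le_mul (le_abs_self c) (by nlinarith) (by positivity) (abs_nonneg c))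
      calc _ ≤ (‖ι‖ + 1) * ‖t‖ := by rw [e2]; linarith
        _ ≤ (‖ι‖ + 1) * (|c| * ((‖ι‖ + 1) * (‖(p : V × X)‖ + ‖G p‖))) := by gcongr
        _ = _ := by ring)
  -- The term `T₂` enters as `(v, x) ↦ (0, T₂ v)`, bounded on `V × X`.
  obtain ⟨S', hS', hSS'⟩ := hS.exists_perturb
    (ContinuousLinearMap.inr ℂ V X ∘L T₂ ∘L ContinuousLinearMap.fst ℂ V X)
  refine ⟨S', hS', ?_⟩
  rintro ⟨v, x⟩ ⟨w, y⟩
  refine Iff.trans ?_ (hSS' (v, x) (w, y)).symm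
  have e0 : ((w, y) : V × X) - (ContinuousLinearMap.inr ℂ V X ∘L T₂ ∘L
      ContinuousLinearMap.fst ℂ V X) (v, x) = (w, y - T₂ v) := Prod.ext (sub_zero w) rfl
  rw [e0, hSG, mem_graph_reductionMatrix hι, hA']
  constructor
  · rintro ⟨rfl, hx, hy⟩
    have hd : (v, ι w) ∈ G.domain := ⟨hx, ⟨w, rfl⟩⟩
    have h1 : G ⟨(v, ι w), hd⟩ = (w, A ⟨ι v, hx⟩) :=
      reductionMatrix_apply_eq hι ⟨rfl, A.mem_graph ⟨ι v, hx⟩⟩ _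
    refine ⟨hd, ?_⟩
    rw [hK, h1, Prod.mk_add_mk, add_zero, ← hy, add_sub_cancel_right]
  · rintro ⟨hd, hp⟩
    obtain ⟨w', rfl⟩ : x ∈ LinearMap.range (ι : V →ₗ[ℂ] X) := hd.2
    have hx : ι v ∈ A.domain := hd.1
    have h1 : G ⟨(v, ι w'), hd⟩ = (w', A ⟨ι v, hx⟩) :=
      reductionMatrix_apply_eq hι ⟨rfl, A.mem_graph ⟨ι v, hx⟩⟩ _
    have h2 : G ⟨(v, ι w'), hd⟩ + (K ⟨(v, ι w'), hd⟩ : V × X) = (w, y - T₂ v) := hp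
    rw [hK, h1, Prod.mk_add_mk, add_zero] at h2
    obtain ⟨rfl, h3⟩ := Prod.mk.inj h2
    exact ⟨rfl, hx, by rw [h3, sub_add_cancel]⟩

end PerturbReduction

/-! ### Calculus of graph-bounded maps. -/

section GraphBounded

variable {E F : Type*} [NormedAddCommGroup E] [NormedSpace ℂ E]
  [NormedAddCommGroup F] [NormedSpace ℂ F] {A : E →ₗ.[ℂ] E}

theorem graphBounded_zero : GraphBounded A (0 : A.domain →ₗ[ℂ] F) := ⟨0, by simp⟩

theorem GraphBounded.add {S T : A.domain →ₗ[ℂ] F} (hS : GraphBounded A S)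
    (hT : GraphBounded A T) : GraphBounded A (S + T) := by
  obtain ⟨c, hc⟩ := hS
  obtain ⟨d, hd⟩ := hT
  refine ⟨c + d, fun x => (norm_add_le _ _).trans ?_⟩
  rw [add_mul]
  exact add_le_add (hc x) (hd x)

theorem graphBounded_sum {κ : Type*} (s : Finset κ) {T : κ → A.domain →ₗ[ℂ] F}
    (h : ∀ k ∈ s, GraphBounded A (T k)) : GraphBounded A (∑ k ∈ s, T k) :=
  Finset.sum_induction T (GraphBounded A) (fun _ _ => GraphBounded.add) graphBounded_zero h

theorem graphBounded_pi {κ : Type*} [Fintype κ] {F : κ → Type*} [∀ k, NormedAddCommGroup (F k)]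
    [∀ k, NormedSpace ℂ (F k)] {T : ∀ k, A.domain →ₗ[ℂ] F k} (h : ∀ k, GraphBounded A (T k)) :
    GraphBounded A (LinearMap.pi T) := by
  choose c hc using h
  refine ⟨∑ k, |c k|, fun x => (pi_norm_le_iff_of_nonneg (by positivity)).2 fun k => ?_⟩
  refine (hc k x).trans (mul_le_mul_of_nonneg_right ?_ (by positivity))
  exact (le_abs_self _).trans (Finset.single_le_sum (f := fun k => |c k|)
    (fun i _ => abs_nonneg _) (Finset.mem_univ k))

/-- Writing either alternative as a sum with one zero term lets all entries be treated together,
whichever alternative each satisfies. -/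
theorem AdmissibleCoupling.exists_decomposition {V X W Y : Type*}
    [NormedAddCommGroup V] [NormedSpace ℂ V] [NormedAddCommGroup X] [NormedSpace ℂ X]
    [NormedAddCommGroup W] [NormedSpace ℂ W] [NormedAddCommGroup Y] [NormedSpace ℂ Y]
    {ι : V →L[ℂ] X} {κ : W →L[ℂ] Y} {A : X →ₗ.[ℂ] X} {B : A.domain →ₗ[ℂ] Y}
    (h : AdmissibleCoupling ι κ A B) :
    ∃ (T : A.domain →ₗ[ℂ] W) (S : V →L[ℂ] Y), GraphBounded A T ∧
      ∀ (x : A.domain) (v : V), ι v = x → B x = κ (T x) + S v := by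
  rcases h with ⟨T, hT, h⟩ | ⟨S, h⟩
  · exact ⟨T, 0, hT, fun x v _ => by simp [h]⟩
  · exact ⟨0, S, graphBounded_zero, fun x v hv => by simp [h x v hv]⟩

end GraphBounded

/-! ### The coupled system. -/

section Coupling

variable {n : ℕ} {X V : Fin n → Type*}
  [∀ i, NormedAddCommGroup (X i)] [∀ i, NormedSpace ℂ (X i)]
  [∀ i, NormedAddCommGroup (V i)] [∀ i, NormedSpace ℂ (V i)]
  {ι : ∀ i, V i →L[ℂ] X i} {A : ∀ i, X i →ₗ.[ℂ] X i}

theorem mem_graph_coupledOperator {B C : ∀ i j : Fin n, (A j).domain →ₗ[ℂ] X i}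
    {x y : ∀ i, X i} : (x, y) ∈ (coupledOperator A B C).graph ↔
      ∃ hx : ∀ i, x i ∈ (A i).domain, ∀ i, A i ⟨x i, hx i⟩
          + ∑ k ∈ Finset.Ioi i, B i k ⟨x k, hx k⟩
          + ∑ h ∈ Finset.Iio i, C i h ⟨x h, hx h⟩ = y i := by
  rw [LinearPMap.mem_graph_iff]
  constructor
  · rintro ⟨⟨z, hz⟩, h1, h2⟩
    simp only [] at h1 h2
    subst h1
    exact ⟨fun i => hz i trivial, fun i => congrFun h2 i⟩
  · rintro ⟨hx, h⟩
    exact ⟨⟨x, fun i _ => hx i⟩, rfl, funext h⟩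

theorem mem_graph_coupledOperator_zero {x y : ∀ i, X i} :
    (x, y) ∈ (coupledOperator A 0 0).graph ↔ ∀ i, (x i, y i) ∈ (A i).graph := by
  rw [mem_graph_coupledOperator]
  simp only [Pi.zero_apply, LinearMap.zero_apply, Finset.sum_const_zero, add_zero]
  constructor
  · rintro ⟨hx, h⟩ i
    rw [← h i]
    exact (A i).mem_graph ⟨x i, hx i⟩
  · intro h
    refine ⟨fun i => LinearPMap.mem_domain_of_mem_graph (h i), fun i => ?_⟩
    exact LinearPMap.mem_graph_snd_inj' _ ((A i).mem_graph ⟨x i, _⟩) (h i) rfl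

theorem coupledOperator_zero_apply (x : (coupledOperator A 0 0).domain) (i : Fin n) :
    coupledOperator A 0 0 x i = A i ⟨x.1 i, x.2 i trivial⟩ := by
  change A i _ + ∑ k ∈ Finset.Ioi i, _ + ∑ k ∈ Finset.Iio i, _ = _
  simp

/-- The product of the semigroups, with `∏ (V i × X i)` regrouped as `(∏ V i) × (∏ X i)`; limits are
taken componentwise. -/
theorem generatesC0Semigroup_reductionMatrix_pi (hι : ∀ i, Function.Injective (ι i))
    (hι' : Function.Injective (ContinuousLinearMap.piMap ι))
    (h : ∀ i, GeneratesC0Semigroup (reductionMatrix (ι i) (hι i) (A i))) :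
    GeneratesC0Semigroup
      (reductionMatrix (ContinuousLinearMap.piMap ι) hι' (coupledOperator A 0 0)) := by
  choose T hT hG using h
  let e : ∀ i, ((∀ i, V i) × (∀ i, X i)) →L[ℂ] V i × X i := fun i =>
    (ContinuousLinearMap.proj i).prodMap (ContinuousLinearMap.proj i)
  let S : ℝ → ((∀ i, V i) × (∀ i, X i)) →L[ℂ] ((∀ i, V i) × (∀ i, X i)) := fun t =>
    (ContinuousLinearMap.pi fun i => ContinuousLinearMap.fst ℂ _ _ ∘L T i t ∘L e i).prod
      (ContinuousLinearMap.pi fun i => ContinuousLinearMap.snd ℂ _ _ ∘L T i t ∘L e i)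
  have hS : ∀ t v x, S t (v, x) = (fun i => (T i t (v i, x i)).1, fun i => (T i t (v i, x i)).2) :=
    fun t v x => rfl
  refine ⟨S, ⟨?_, fun s t hs ht => ?_, ?_⟩, ?_⟩
  · refine ContinuousLinearMap.ext ?_
    rintro ⟨v, x⟩
    rw [hS]
    simp only [(hT _).zero_apply]
    rfl
  · refine ContinuousLinearMap.ext ?_
    rintro ⟨v, x⟩
    change S (s + t) (v, x) = S s (S t (v, x))
    rw [hS, hS t, hS s]
    simp only [(hT _).map_add_apply hs ht]
  · rintro ⟨v, x⟩
    simp only [hS]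
    refine ContinuousOn.prodMk (continuousOn_pi.2 fun i => ?_) (continuousOn_pi.2 fun i => ?_)
    · exact continuous_fst.comp_continuousOn ((hT i).continuousOn (v i, x i))
    · exact continuous_snd.comp_continuousOn ((hT i).continuousOn (v i, x i))
  · rintro ⟨v, x⟩ ⟨w, y⟩
    rw [mem_graph_reductionMatrix hι', mem_graph_coupledOperator_zero, Prod.tendsto_iff,
      tendsto_pi_nhds, tendsto_pi_nhds, funext_iff, ← forall_and, ← forall_and]
    refine forall_congr' fun i => ?_
    refine Iff.trans ?_ (Prod.tendsto_iff
      (fun t : ℝ => t⁻¹ • (T i t (v i, x i) - (v i, x i))) (w i, y i))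
    rw [← hG, mem_graph_reductionMatrix (hι i)]
    rfl

theorem generatesC0Semigroup_reductionMatrix_coupledOperator
    [∀ i, CompleteSpace (X i)] [∀ i, CompleteSpace (V i)] (hι : ∀ i, Function.Injective (ι i))
    (hι' : Function.Injective (ContinuousLinearMap.piMap ι))
    (h : ∀ i, GeneratesC0Semigroup (reductionMatrix (ι i) (hι i) (A i)))
    (B C : ∀ i j : Fin n, (A j).domain →ₗ[ℂ] X i)
    (hB : ∀ h k : Fin n, h < k → AdmissibleCoupling (ι k) (ι h) (A k) (B h k))
    (hC : ∀ h k : Fin n, h < k → AdmissibleCoupling (ι h) (ι k) (A h) (C k h)) :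
    GeneratesC0Semigroup
      (reductionMatrix (ContinuousLinearMap.piMap ι) hι' (coupledOperator A B C)) := by
  have hdec : ∀ (D : ∀ i j : Fin n, (A j).domain →ₗ[ℂ] X i) (r : Fin n → Fin n → Prop),
      (∀ i k, r i k → AdmissibleCoupling (ι k) (ι i) (A k) (D i k)) →
      ∀ i k, ∃ (T : (A k).domain →ₗ[ℂ] V i) (S : V k →L[ℂ] X i), GraphBounded (A k) T ∧
        (r i k → ∀ (x : (A k).domain) (v : V k), ι k v = x → D i k x = ι i (T x) + S v) := by
    intro D r hr i k
    by_cases hik : r i k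
    · obtain ⟨T, S, hT, hTS⟩ := (hr i k hik).exists_decomposition
      exact ⟨T, S, hT, fun _ => hTS⟩
    -- Entries outside the relevant triangle never enter the sums, so any decomposition serves.
    · exact ⟨0, 0, graphBounded_zero, fun h => absurd h hik⟩
  choose TB SB hTB hBeq using hdec B (fun i k => i < k) hB
  choose TC SC hTC hCeq using hdec C (fun i k => k < i) fun i k hik => hC k i hik
  let π : ∀ k, (coupledOperator A 0 0).domain →ₗ[ℂ] (A k).domain := fun k =>
    { toFun := fun x => ⟨x.1 k, x.2 k trivial⟩
      map_add' := fun _ _ => rfl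
      map_smul' := fun _ _ => rfl }
  -- The graph norm of the diagonal operator dominates that of each `A k`.
  have hπ : ∀ {i k} {T : (A k).domain →ₗ[ℂ] V i}, GraphBounded (A k) T →
      GraphBounded (coupledOperator A 0 0) (T ∘ₗ π k) := by
    rintro i k T ⟨c, hc⟩
    refine ⟨|c|, fun x => (hc (π k x)).trans ?_⟩
    have e1 : ‖(π k x : X k)‖ ≤ ‖(x : ∀ i, X i)‖ := norm_le_pi_norm x.1 k
    have e2 : ‖A k (π k x)‖ ≤ ‖coupledOperator A 0 0 x‖ := by
      have := norm_le_pi_norm (coupledOperator A 0 0 x) k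
      rwa [coupledOperator_zero_apply] at this
    exact mul_le_mul (le_abs_self c) (add_le_add e1 e2) (by positivity) (abs_nonneg c)
  refine generatesC0Semigroup_reductionMatrix_perturb hι'
    (generatesC0Semigroup_reductionMatrix_pi hι hι' h)
    (LinearMap.pi fun i => ∑ k ∈ Finset.Ioi i, TB i k ∘ₗ π k + ∑ k ∈ Finset.Iio i, TC i k ∘ₗ π k)
    (graphBounded_pi fun i => (graphBounded_sum _ fun k _ => hπ (hTB i k)).add
      (graphBounded_sum _ fun k _ => hπ (hTC i k)))
    (ContinuousLinearMap.pi fun i => ∑ k ∈ Finset.Ioi i, SB i k ∘L ContinuousLinearMap.proj k +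
      ∑ k ∈ Finset.Iio i, SC i k ∘L ContinuousLinearMap.proj k) fun v y => ?_
  rw [mem_graph_coupledOperator]
  have hdom : (∀ i, ContinuousLinearMap.piMap ι v i ∈ (A i).domain) ↔
      ContinuousLinearMap.piMap ι v ∈ (coupledOperator A 0 0).domain :=
    ⟨fun h i _ => h i, fun h i => h i trivial⟩
  suffices key : ∀ (hx : ∀ i, ContinuousLinearMap.piMap ι v i ∈ (A i).domain) (i : Fin n),
      A i ⟨_, hx i⟩ + ∑ k ∈ Finset.Ioi i, B i k ⟨_, hx k⟩ + ∑ k ∈ Finset.Iio i, C i k ⟨_, hx k⟩ =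
      (coupledOperator A 0 0 ⟨_, hdom.1 hx⟩ + ContinuousLinearMap.piMap ι
        (LinearMap.pi (fun i => ∑ k ∈ Finset.Ioi i, TB i k ∘ₗ π k +
          ∑ k ∈ Finset.Iio i, TC i k ∘ₗ π k) ⟨_, hdom.1 hx⟩) +
        ContinuousLinearMap.pi (fun i =>
          ∑ k ∈ Finset.Ioi i, SB i k ∘L ContinuousLinearMap.proj k +
          ∑ k ∈ Finset.Iio i, SC i k ∘L ContinuousLinearMap.proj k) v) i from
    ⟨fun ⟨hx, h⟩ => ⟨hdom.1 hx, funext fun i => (key hx i).symm.trans (h i)⟩,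
      fun ⟨hx, h⟩ => ⟨hdom.2 hx, fun i => (key (hdom.2 hx) i).trans (congrFun h i)⟩⟩
  intro hx i
  have e1 : ∑ k ∈ Finset.Ioi i, B i k ⟨_, hx k⟩ =
      ∑ k ∈ Finset.Ioi i, (ι i (TB i k ⟨_, hx k⟩) + SB i k (v k)) :=
    Finset.sum_congr rfl fun k hk => hBeq i k (Finset.mem_Ioi.1 hk) _ _ rfl
  have e2 : ∑ k ∈ Finset.Iio i, C i k ⟨_, hx k⟩ =
      ∑ k ∈ Finset.Iio i, (ι i (TC i k ⟨_, hx k⟩) + SC i k (v k)) :=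
    Finset.sum_congr rfl fun k hk => hCeq i k (Finset.mem_Iio.1 hk) _ _ rfl
  rw [e1, e2, Finset.sum_add_distrib, Finset.sum_add_distrib, Pi.add_apply, Pi.add_apply,
    coupledOperator_zero_apply]
  have e3 : ∀ z, ContinuousLinearMap.piMap ι z i = ι i (z i) := fun z => rfl
  rw [e3 (LinearMap.pi _ _), LinearMap.pi_apply, ContinuousLinearMap.pi_apply]
  simp only [LinearMap.add_apply, LinearMap.sum_apply, LinearMap.comp_apply, map_add, map_sum,
    add_apply, sum_apply, ContinuousLinearMap.comp_apply, ContinuousLinearMap.proj_apply]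
  change _ = _ + (∑ k ∈ Finset.Ioi i, ι i (TB i k ⟨_, hx k⟩) +
    ∑ k ∈ Finset.Iio i, ι i (TC i k ⟨_, hx k⟩)) + _
  abel

end Coupling

end CosineSystem

end

theorem theorem4p1 {n : ℕ} {X V : Fin n → Type*}
    [∀ i, NormedAddCommGroup (X i)] [∀ i, NormedSpace ℂ (X i)] [∀ i, CompleteSpace (X i)]
    [∀ i, NormedAddCommGroup (V i)] [∀ i, NormedSpace ℂ (V i)] [∀ i, CompleteSpace (V i)]
    (ι : ∀ i, V i →L[ℂ] X i) (A : ∀ i, X i →ₗ.[ℂ] X i)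
    (hA : ∀ i, CosineSystem.GeneratesCOFWithPhaseSpace (ι i) (A i))
    (B C : ∀ i j : Fin n, (A j).domain →ₗ[ℂ] X i)
    (hB : ∀ h k : Fin n, h < k → CosineSystem.AdmissibleCoupling (ι k) (ι h) (A k) (B h k))
    (hC : ∀ h k : Fin n, h < k → CosineSystem.AdmissibleCoupling (ι h) (ι k) (A h) (C k h)) :
    CosineSystem.GeneratesCOFWithPhaseSpace (ContinuousLinearMap.piMap ι)
        (CosineSystem.coupledOperator A B C) ∧
      CosineSystem.WellPosed (ContinuousLinearMap.piMap ι)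
        (CosineSystem.coupledOperator A B C) := by
  have hι : Function.Injective (ContinuousLinearMap.piMap ι) := fun v w h =>
    funext fun i => (hA i).injective (congrFun h i)
  have hdom : ∀ x ∈ (CosineSystem.coupledOperator A B C).domain,
      x ∈ range (ContinuousLinearMap.piMap ι) := by
    intro x hx
    choose j hj _ using fun i => (hA i).domainEmbeds
    exact ⟨fun i => j i ⟨x i, hx i trivial⟩, funext fun i => hj i _⟩
  have h := CosineSystem.generatesC0Semigroup_reductionMatrix_coupledOperator
    (fun i => (hA i).injective) hι (fun i => (hA i).reduction) B C hB hC
  exact ⟨CosineSystem.generatesCOFWithPhaseSpace_of_reduction hι hdom h,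
    CosineSystem.wellPosed_of_reduction hι hdom h⟩
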